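/- Let $M$ be a smooth $n$-dimensional manifold (without boundary) and let $J\subset\mathbb R$ be an interval containing more than one point. For $t\in J$ let $g_t$ be a Riemannian metric on $M$, $H_t=\sum_{k=1}^n H_{k,t}$ a differential form of mixed degree with $H_{k,t}\in\Lambda^kT^*M$, and $f_t$ a real function on $M$, all jointly smooth in $(t,x)\in J\times M$. Norms and inner products of tensors and of forms are the tensor ones, $\langle S,T\rangle=g^{i_1j_1}\cdots g^{i_kj_k}S_{i_1\dots i_k}T_{j_1\dots j_k}$, and components of different degree are orthogonal. Put $$H^2(X,Y)=\langle i_XH,i_YH\rangle .$$ Let $\mathrm{Rc}$ and $R$ be the Ricci and scalar curvature of $g$, let $\Delta$ be the Laplace–Beltrami operator on functions, let $d^*_g$ be the codifferential, $(d^*_gH)_{i_2\dots i_k}=-g^{ij}\nabla_iH_{ji_2\dots i_k}$, and let $\Delta_d=-(dd^*_g+d^*_gd)$. Assume that every $H_t$ is closed and that $(g_t,H_t,f_t)$ solves the generalized Ricci flow on $J$ (with one-sided time derivatives at end points of $J$): $$\partial_tg=-2\,\mathrm{Rc}+\tfrac12H^2-2\nabla^2f,\qquad \partial_tH=\Delta_dH-d\,i_{\nabla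 f}H,\qquad \partial_tf=\Delta f+\tfrac14\sum_{k=1}^n\tfrac{k-1}{k}|H_k|^2-|\nabla f|^2 .$$ Define the generalized Ricci tensor and scalar curvature $$\mathrm{Rc}^{H,f}=\mathrm{Rc}-\tfrac14H^2+\nabla^2f-\tfrac12\left(d^*_gH+i_{\nabla f}H\right)\in \mathrm{Sym}^2T^*M\oplus\bigoplus_{k=0}^{n-1}\Lambda^kT^*M,$$ $$R^{H,f}=R-\tfrac14\sum_{k=1}^n\tfrac1k|H_k|^2+2\Delta f-|\nabla f|^2,$$ and the weighted heat operator $\square_fu=\partial_tu-\Delta u+\langle\nabla f,\nabla u\rangle$. Then $R^{H,f}$ is smooth on $J\times M$ and $$\square_fR^{H,f}=2\,\bigl|\mathrm{Rc}^{H,f}\bigr|^2\qquad\text{on } J\times M,$$ where $|\mathrm{Rc}^{H,f}|^2=\bigl|\mathrm{Rc}-\tfrac14H^2+\nabla^2f\bigr|^2+\tfrac14\bigl|d^*_gH+i_{\nabla f}H\bigr|^2$. -/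

import Mathlib

open scoped Manifold ContDiff Topology

noncomputable section

namespace GenRicciFlow

/-! ## Tensor calculus in local coordinates

Coordinates take values in an open subset of `ℝⁿ`. A Riemannian metric is given there by its
matrix of components `G y i j = g_{ij}(y)`, and a covariant `k`-tensor field (in particular a
differential `k`-form) by its components `T y I = T(∂_{I 0}, …, ∂_{I (k-1)})(y)`. -/

/-- The model space `ℝⁿ` in which coordinates take their values. -/
abbrev Coord (n : ℕ) : Type := EuclideanSpace ℝ (Fin n)

/-- Components of a covariant `k`-tensor at a point. -/
abbrev Comp (n k : ℕ) : Type := (Fin k → Fin n) → ℝ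

variable {n : ℕ}

/-- The `i`-th coordinate vector of `ℝⁿ`. -/
def coordVec (i : Fin n) : Coord n := EuclideanSpace.single i (1 : ℝ)

/-- The partial derivative `∂_i u`. -/
def pd (i : Fin n) (u : Coord n → ℝ) (y : Coord n) : ℝ := fderiv ℝ u y (coordVec i)

/-- Christoffel symbols
`Γ^k_{ij} = ½ g^{kl} (∂_i g_{jl} + ∂_j g_{il} - ∂_l g_{ij})`. -/
def christoffel (G : Coord n → Matrix (Fin n) (Fin n) ℝ) (k i j : Fin n) (y : Coord n) : ℝ :=
  (1 / 2) * ∑ l, (G y)⁻¹ k l *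
    (pd i (fun z => G z j l) y + pd j (fun z => G z i l) y - pd l (fun z => G z i j) y)

/-- The curvature tensor, `R(∂_i, ∂_j) ∂_k = R^l_{ijk} ∂_l`, where
`R(X, Y) Z = ∇_X ∇_Y Z - ∇_Y ∇_X Z - ∇_{[X, Y]} Z` for the Levi-Civita connection. -/
def riemann (G : Coord n → Matrix (Fin n) (Fin n) ℝ) (l i j k : Fin n) (y : Coord n) : ℝ :=
  pd i (christoffel G l j k) y - pd j (christoffel G l i k) y
    + ∑ m, (christoffel G l i m y * christoffel G m j k y
      - christoffel G l j m y * christoffel G m i k y)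

/-- The Ricci tensor `Rc_{jk} = R^i_{ijk}`. -/
def ricci (G : Coord n → Matrix (Fin n) (Fin n) ℝ) (y : Coord n) (j k : Fin n) : ℝ :=
  ∑ i, riemann G i i j k y

/-- The trace `g^{ij} S_{ij}` of a covariant 2-tensor. -/
def trace (G : Coord n → Matrix (Fin n) (Fin n) ℝ) (y : Coord n) (S : Fin n → Fin n → ℝ) : ℝ :=
  ∑ i, ∑ j, (G y)⁻¹ i j * S i j

/-- The scalar curvature `R = g^{jk} Rc_{jk}`. -/
def scalarCurv (G : Coord n → Matrix (Fin n) (Fin n) ℝ) (y : Coord n) : ℝ :=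
  trace G y (ricci G y)

/-- The gradient `(∇u)^i = g^{ij} ∂_j u`. -/
def grad (G : Coord n → Matrix (Fin n) (Fin n) ℝ) (u : Coord n → ℝ) (y : Coord n)
    (i : Fin n) : ℝ :=
  ∑ j, (G y)⁻¹ i j * pd j u y

/-- `⟨∇u, ∇v⟩`, that is, the derivative of `v` in the direction `∇u`. -/
def gradInner (G : Coord n → Matrix (Fin n) (Fin n) ℝ) (u v : Coord n → ℝ) (y : Coord n) : ℝ :=
  ∑ i, grad G u y i * pd i v y

/-- The Hessian `(∇²u)_{ij} = ∂_i ∂_j u - Γ^k_{ij} ∂_k u`. -/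
def hess (G : Coord n → Matrix (Fin n) (Fin n) ℝ) (u : Coord n → ℝ) (y : Coord n)
    (i j : Fin n) : ℝ :=
  pd i (pd j u) y - ∑ k, christoffel G k i j y * pd k u y

/-- The Laplace–Beltrami operator `Δu = tr ∇²u`. -/
def lap (G : Coord n → Matrix (Fin n) (Fin n) ℝ) (u : Coord n → ℝ) (y : Coord n) : ℝ :=
  trace G y (hess G u y)

/-- The inner product of covariant `k`-tensors,
`⟨S, T⟩ = g^{i₁j₁} ⋯ g^{iₖjₖ} S_{i₁…iₖ} T_{j₁…jₖ}` (all indices are summed, also for forms). -/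
def tensorInner {k : ℕ} (G : Coord n → Matrix (Fin n) (Fin n) ℝ) (y : Coord n)
    (S T : Comp n k) : ℝ :=
  ∑ I : Fin k → Fin n, ∑ J : Fin k → Fin n, (∏ a, (G y)⁻¹ (I a) (J a)) * S I * T J

/-- The interior product: insertion of the vector `X` into the first slot. -/
def interior {k : ℕ} (X : Fin n → ℝ) (T : Comp n (k + 1)) : Comp n k :=
  fun J => ∑ i, X i * T (Fin.cons i J)

/-- The covariant derivative, the direction of differentiation being the first index:
`(∇T)_{i i₁…iₖ} = ∂_i T_{i₁…iₖ} - ∑_a Γ^m_{i i_a} T_{i₁…m…iₖ}` (`m` in the place of `i_a`). -/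
def covDeriv {k : ℕ} (G : Coord n → Matrix (Fin n) (Fin n) ℝ) (T : Coord n → Comp n k)
    (y : Coord n) : Comp n (k + 1) :=
  fun I => pd (I 0) (fun z => T z (Fin.tail I)) y
    - ∑ a : Fin k, ∑ m : Fin n,
        christoffel G m (I 0) (Fin.tail I a) y * T y (Function.update (Fin.tail I) a m)

/-- The exterior derivative of a `k`-form,
`(dα)_{i₀…iₖ} = ∑_a (-1)^a ∂_{i_a} α_{i₀…î_a…iₖ}`. -/
def extD {k : ℕ} (α : Coord n → Comp n k) (y : Coord n) : Comp n (k + 1) :=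
  fun I => ∑ a : Fin (k + 1), (-1 : ℝ) ^ (a : ℕ) * pd (I a) (fun z => α z (a.removeNth I)) y

/-- The codifferential, `(d^*α)_{i₂…iₖ} = - g^{ij} (∇_i α)_{j i₂…iₖ}`. -/
def coD {k : ℕ} (G : Coord n → Matrix (Fin n) (Fin n) ℝ) (α : Coord n → Comp n (k + 1))
    (y : Coord n) : Comp n k :=
  fun J => -∑ i, ∑ j, (G y)⁻¹ i j * covDeriv G α y (Fin.cons i (Fin.cons j J))

/-- The Hodge Laplacian with the analyst's sign, `Δ_d = -(d d^* + d^* d)`,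
on forms of positive degree. -/
def hodgeLap {k : ℕ} (G : Coord n → Matrix (Fin n) (Fin n) ℝ) (α : Coord n → Comp n (k + 1))
    (y : Coord n) : Comp n (k + 1) :=
  fun I => -(extD (coD G α) y I + coD G (extD α) y I)

/-! ### Forms of mixed degree

A form `H = H_1 + ⋯ + H_n` of mixed positive degree is a family indexed by `j : Fin n`;
the member with index `j` has degree `j + 1`. -/

/-- `H²(∂_i, ∂_j) = ⟨i_{∂_i} H, i_{∂_j} H⟩`, components of different degree being orthogonal. -/
def formSq (G : Coord n → Matrix (Fin n) (Fin n) ℝ)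
    (H : (j : Fin n) → Coord n → Comp n (j + 1)) (y : Coord n) (p q : Fin n) : ℝ :=
  ∑ j : Fin n, tensorInner G y (interior (Pi.single p 1) (H j y))
    (interior (Pi.single q 1) (H j y))

/-- The weighted sum `∑_k (1 / k) |H_k|²`. -/
def wNormSq (G : Coord n → Matrix (Fin n) (Fin n) ℝ)
    (H : (j : Fin n) → Coord n → Comp n (j + 1)) (y : Coord n) : ℝ :=
  ∑ j : Fin n, (1 / ((j : ℝ) + 1)) * tensorInner G y (H j y) (H j y)

/-- The weighted sum `∑_k ((k - 1) / k) |H_k|²`. -/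
def wwNormSq (G : Coord n → Matrix (Fin n) (Fin n) ℝ)
    (H : (j : Fin n) → Coord n → Comp n (j + 1)) (y : Coord n) : ℝ :=
  ∑ j : Fin n, ((j : ℝ) / ((j : ℝ) + 1)) * tensorInner G y (H j y) (H j y)

/-- The symmetric part `Rc - ¼ H² + ∇²f` of the generalized Ricci tensor `Rc^{H,f}`. -/
def genRicciSym (G : Coord n → Matrix (Fin n) (Fin n) ℝ)
    (H : (j : Fin n) → Coord n → Comp n (j + 1)) (f : Coord n → ℝ) (y : Coord n) : Comp n 2 :=
  fun I => ricci G y (I 0) (I 1) - (1 / 4) * formSq G H y (I 0) (I 1) + hess G f y (I 0) (I 1)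

/-- The part `-½ (d^*H + i_{∇f} H)` of the generalized Ricci tensor `Rc^{H,f}` in
`Λ^0 ⊕ ⋯ ⊕ Λ^{n-1}`; the member with index `j` has degree `j`. -/
def genRicciForm (G : Coord n → Matrix (Fin n) (Fin n) ℝ)
    (H : (j : Fin n) → Coord n → Comp n (j + 1)) (f : Coord n → ℝ) (y : Coord n)
    (j : Fin n) : Comp n j :=
  fun J => -(1 / 2) * (coD G (H j) y J + interior (grad G f y) (H j y) J)

/-- `|Rc^{H,f}|²` in the direct sum `Sym² ⊕ Λ^0 ⊕ ⋯ ⊕ Λ^{n-1}`. -/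
def genRicciNormSq (G : Coord n → Matrix (Fin n) (Fin n) ℝ)
    (H : (j : Fin n) → Coord n → Comp n (j + 1)) (f : Coord n → ℝ) (y : Coord n) : ℝ :=
  tensorInner G y (genRicciSym G H f y) (genRicciSym G H f y)
    + ∑ j : Fin n, tensorInner G y (genRicciForm G H f y j) (genRicciForm G H f y j)

/-- The generalized scalar curvature
`R^{H,f} = R - ¼ ∑_k (1 / k) |H_k|² + 2 Δf - |∇f|²`. -/
def genScalar (G : Coord n → Matrix (Fin n) (Fin n) ℝ)
    (H : (j : Fin n) → Coord n → Comp n (j + 1)) (f : Coord n → ℝ) (y : Coord n) : ℝ :=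
  scalarCurv G y - (1 / 4) * wNormSq G H y + 2 * lap G f y - gradInner G f f y

/-- The weighted heat operator `□_f u = ∂_t u - Δu + ⟨∇f, ∇u⟩` at time `t`, for `t` in the time
interval `J` (one-sided time derivatives at end points that belong to `J`). -/
def weightedBox (J : Set ℝ) (G : ℝ → Coord n → Matrix (Fin n) (Fin n) ℝ) (f : ℝ → Coord n → ℝ)
    (u : ℝ → Coord n → ℝ) (t : ℝ) (y : Coord n) : ℝ :=
  derivWithin (fun s => u s y) J t - lap (G t) (u t) y + gradInner (G t) (f t) (u t) y

/-! ## Geometric objects on a manifold and their coordinate expressions -/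

section Manifold

variable {M : Type*} [TopologicalSpace M] [ChartedSpace (EuclideanSpace ℝ (Fin n)) M]

/-- The coordinate vector field `∂_i` of the chart `e`, at the point with coordinates `y`. -/
def frame (e : OpenPartialHomeomorph M (Coord n)) (y : Coord n) (i : Fin n) :
    TangentSpace (𝓡 n) (e.symm y) :=
  mfderiv 𝓘(ℝ, EuclideanSpace ℝ (Fin n)) (𝓡 n) e.symm y (coordVec i)

/-- A family of differential forms on `M`, one of each degree `1, …, n` (pointwise data; its
smoothness is imposed in coordinates). The member with index `j` has degree `j + 1`. -/
abbrev MixedForm (n : ℕ) (M : Type*) [TopologicalSpace M]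
    [ChartedSpace (EuclideanSpace ℝ (Fin n)) M] : Type _ :=
  (j : Fin n) → (x : M) → TangentSpace (𝓡 n) x [⋀^Fin ((j : ℕ) + 1)]→L[ℝ] ℝ

/-- The components `H_{i₁…iₖ}` in the chart `e` of the homogeneous parts of `H`. -/
def formComp (H : MixedForm n M) (e : OpenPartialHomeomorph M (Coord n)) (j : Fin n)
    (y : Coord n) : Comp n (j + 1) :=
  fun I => H j (e.symm y) (fun a => frame e y (I a))

/-- The coordinate expression of a function in the chart `e`. -/
def funComp (f : M → ℝ) (e : OpenPartialHomeomorph M (Coord n)) (y : Coord n) : ℝ :=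
  f (e.symm y)

/-- A mixed form is closed: in every smooth chart, `dH = 0`. -/
def IsClosedForm (H : MixedForm n M) : Prop :=
  ∀ e ∈ IsManifold.maximalAtlas (𝓡 n) ∞ M, ∀ y ∈ e.target, ∀ j : Fin n,
    extD (formComp H e j) y = 0

variable [IsManifold (𝓡 n) ∞ M]

/-- Smooth Riemannian metrics on the `n`-manifold `M`. -/
abbrev Metric (n : ℕ) (M : Type*) [TopologicalSpace M]
    [ChartedSpace (EuclideanSpace ℝ (Fin n)) M] [IsManifold (𝓡 n) ∞ M] : Type _ :=
  Bundle.ContMDiffRiemannianMetric (𝓡 n) ∞ (EuclideanSpace ℝ (Fin n))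
    (fun x : M => TangentSpace (𝓡 n) x)

/-- The components `g_{ij} = g(∂_i, ∂_j)` in the chart `e`. -/
def metricComp (g : Metric n M) (e : OpenPartialHomeomorph M (Coord n)) (y : Coord n) :
    Matrix (Fin n) (Fin n) ℝ :=
  Matrix.of fun i j => g.inner (e.symm y) (frame e y i) (frame e y j)

/-- `(g_t, H_t, f_t)`, `t ∈ J`, is a smooth one-parameter family (jointly smooth in time and
space) that solves, in every smooth chart,
`∂_t g = -2 Rc + ½ H² - 2 ∇²f`, `∂_t H = Δ_d H - d i_{∇f} H` and
`∂_t f = Δf + ¼ ∑_k ((k - 1) / k) |H_k|² - |∇f|²`. -/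
structure IsGenRicciFlow (J : Set ℝ) (g : ℝ → Metric n M) (H : ℝ → MixedForm n M)
    (f : ℝ → M → ℝ) : Prop where
  smooth_metric : ∀ e ∈ IsManifold.maximalAtlas (𝓡 n) ∞ M, ∀ i j : Fin n,
    ContDiffOn ℝ ∞ (fun p : ℝ × Coord n => metricComp (g p.1) e p.2 i j) (J ×ˢ e.target)
  smooth_form : ∀ e ∈ IsManifold.maximalAtlas (𝓡 n) ∞ M, ∀ (j : Fin n)
    (I : Fin ((j : ℕ) + 1) → Fin n),
    ContDiffOn ℝ ∞ (fun p : ℝ × Coord n => formComp (H p.1) e j p.2 I) (J ×ˢ e.target)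
  smooth_fun : ∀ e ∈ IsManifold.maximalAtlas (𝓡 n) ∞ M,
    ContDiffOn ℝ ∞ (fun p : ℝ × Coord n => funComp (f p.1) e p.2) (J ×ˢ e.target)
  evol_metric : ∀ e ∈ IsManifold.maximalAtlas (𝓡 n) ∞ M, ∀ t ∈ J, ∀ y ∈ e.target,
    ∀ i j : Fin n,
    HasDerivWithinAt (fun s => metricComp (g s) e y i j)
      (-2 * ricci (metricComp (g t) e) y i j
        + (1 / 2) * formSq (metricComp (g t) e) (formComp (H t) e) y i j
        - 2 * hess (metricComp (g t) e) (funComp (f t) e) y i j) J t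
  evol_form : ∀ e ∈ IsManifold.maximalAtlas (𝓡 n) ∞ M, ∀ t ∈ J, ∀ y ∈ e.target,
    ∀ (j : Fin n) (I : Fin ((j : ℕ) + 1) → Fin n),
    HasDerivWithinAt (fun s => formComp (H s) e j y I)
      (hodgeLap (metricComp (g t) e) (formComp (H t) e j) y I
        - extD (fun z => interior (grad (metricComp (g t) e) (funComp (f t) e) z)
            (formComp (H t) e j z)) y I) J t
  evol_fun : ∀ e ∈ IsManifold.maximalAtlas (𝓡 n) ∞ M, ∀ t ∈ J, ∀ y ∈ e.target,
    HasDerivWithinAt (fun s => funComp (f s) e y)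
      (lap (metricComp (g t) e) (funComp (f t) e) y
        + (1 / 4) * wwNormSq (metricComp (g t) e) (formComp (H t) e) y
        - gradInner (metricComp (g t) e) (funComp (f t) e) (funComp (f t) e) y) J t

/-- The coordinate expression in the chart `e` of the scalar curvature `R^{H_t,f_t}` of
`(g_t, H_t, f_t)`, as a function of time and space. -/
def flowScalar (g : ℝ → Metric n M) (H : ℝ → MixedForm n M) (f : ℝ → M → ℝ)
    (e : OpenPartialHomeomorph M (Coord n)) (t : ℝ) (y : Coord n) : ℝ :=
  genScalar (metricComp (g t) e) (formComp (H t) e) (funComp (f t) e) y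

end Manifold

end GenRicciFlow

end

open GenRicciFlow

/-!
The evolution equation is a pointwise identity between the derivatives of `g`, `H` and `f` in a
chart, so it is proved as an identity of differential algebra. For an interval `J` and an open set
`U` of coordinates, the smooth functions on `J × U` form a commutative `ℝ`-algebra `A = SmoothOn`
with commuting derivations `∂ i` and `δ = ∂_t`; every coordinate expression (Christoffel symbols,
curvature, codifferential, …) is the value of an element of `A` built by the same formula
(`Represents` and the lemmas `represents_…`). All calculations then take place in `A`, where no
differentiability has to be checked.

Write `S = Rc - ¼H² + ∇²f`, `K = d^*H + i_{∇f}H`, and `ρ = R^{H,f}`; let `div_f = div - i_{∇f}`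
and `Δ_f = Δ - ⟨∇f, ∇·⟩`. As `H` is closed, the flow equations read
`∂_t g = -2S`, `∂_t H = -dK`, `∂_t f = ρ - tr S`. Two facts give the theorem.

* The generalized contracted Bianchi identity `(div_f S)_m = ½ ∂_m ρ + ¼ ⟨K, i_m H⟩`. Its parts are
  the weighted Bianchi identity `div_f (Rc + ∇²f) = ½ d(R + 2Δf - |∇f|²)`
  (`LeviCivita.weighted_bianchi`, from the second Bianchi and Bochner identities) and
  `(div_f H_k²)_m = (1/(2k)) ∂_m |H_k|² - ⟨K, i_m H_k⟩` for closed `H_k` (`LeviCivita.form_bianchi`).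
* The first variations of `R + 2Δf - |∇f|²` (`LeviCivita.variation_weighted_scal`) and of `|H_k|²`
  (`LeviCivita.variation_innProd_self`). In the former the variation enters through `div_f div_f S`,
  which the Bianchi identity turns into `½ Δ_f ρ + ¼ div_f ⟨K, i H⟩`; the last term equals
  `¼ ∑_k (1/k) ⟨H_k, dK⟩ - ¼ |K|²`, and its first summand cancels against the variation of `|H_k|²`.

What is left is `∂_t ρ = Δ_f ρ + 2|S|² + ½|K|²` (`LeviCivita.evolution_genScal`).

The calculations avoid covariant derivatives of higher tensors. A symmetric 2-tensor is used in its
mixed form `T^l_m`, with divergence `∂_l T^l_m + Γ_l T^l_m - Γ^a_{ml} T^l_a`, where `Γ_l = Γ^j_{jl}`;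
for a form with raised indices, the divergence in the first slot is `∂_l H^{lI} + Γ_l H^{lI}`,
because the remaining Christoffel terms cancel by antisymmetry.
-/

set_option linter.unusedSectionVars false

open scoped Matrix

namespace DiffAlg

open Matrix

section

variable {A : Type*} [CommRing A] [Algebra ℝ A] {ι : Type*} [Fintype ι] [DecidableEq ι]

/-! ### Derivations and matrices -/

section Matrices

lemma map_mul_derivation (δ : Derivation ℝ A A) (M N : Matrix ι ι A) :
    (M * N).map δ = M.map δ * N + M * N.map δ := by
  ext i j
  simp only [Matrix.map_apply, Matrix.mul_apply, Matrix.add_apply, map_sum, Derivation.leibniz,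
    smul_eq_mul, ← Finset.sum_add_distrib]
  exact Finset.sum_congr rfl fun _ _ => by ring

lemma map_add_derivation (δ : Derivation ℝ A A) (M N : Matrix ι ι A) :
    (M + N).map δ = M.map δ + N.map δ := by
  ext i j; simp

lemma map_sub_derivation (δ : Derivation ℝ A A) (M N : Matrix ι ι A) :
    (M - N).map δ = M.map δ - N.map δ := by
  ext i j; simp

lemma map_neg_derivation (δ : Derivation ℝ A A) (M : Matrix ι ι A) :
    (-M).map δ = -M.map δ := by
  ext i j; simp

lemma map_map_comm {δ δ' : Derivation ℝ A A} (h : ∀ a, δ (δ' a) = δ' (δ a)) (M : Matrix ι ι A) :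
    (M.map δ).map δ' = (M.map δ').map δ := by
  ext i j; simp [h]

lemma map_inverse {g q : Matrix ι ι A} (hqg : q * g = 1) (δ : Derivation ℝ A A) :
    q.map δ = -(q * g.map δ * q) := by
  have h1 : (q * g).map δ = 0 := by
    rw [hqg]; ext i j; by_cases h : i = j <;> simp [h]
  rw [map_mul_derivation] at h1
  have hgq : g * q = 1 := mul_eq_one_comm.mp hqg
  calc q.map δ = q.map δ * (g * q) := by rw [hgq, mul_one]
    _ = (q.map δ * g + q * g.map δ) * q - q * g.map δ * q := by noncomm_ring
    _ = _ := by rw [h1]; simp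

lemma trace_variation_comm {g q : Matrix ι ι A} (hqg : q * g = 1) {δ δ' : Derivation ℝ A A}
    (h : ∀ a, δ (δ' a) = δ' (δ a)) :
    δ (q * g.map δ').trace = δ' (q * g.map δ).trace := by
  have key : ∀ (d : Derivation ℝ A A) (M : Matrix ι ι A), d M.trace = (M.map d).trace := by
    intro d M; simp [Matrix.trace]
  rw [key, key, map_mul_derivation, map_mul_derivation, map_inverse hqg, map_inverse hqg,
    map_map_comm h, Matrix.trace_add, Matrix.trace_add]
  congr 1
  simp only [neg_mul, Matrix.trace_neg]
  congr 1
  rw [mul_assoc, Matrix.trace_mul_comm]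
  simp only [mul_assoc]

end Matrices

/-! ### Levi-Civita connection, curvature and the contracted Bianchi identity -/

/-- `Γ` is the Levi-Civita connection of the metric `g` with inverse `q`, for the commuting
derivations `D i` (the coordinate derivatives): it is torsion free and `∇g = 0`.
The entry `Γ i k j` is the Christoffel symbol `Γ^k_{ij}`. -/
structure LeviCivita (D : ι → Derivation ℝ A A) (g q : Matrix ι ι A) (Γ : ι → Matrix ι ι A) :
    Prop where
  comm : ∀ i j a, D i (D j a) = D j (D i a)
  g_symm : gᵀ = g
  q_symm : qᵀ = q
  q_mul_g : q * g = 1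
  Γ_symm : ∀ i k j, Γ i k j = Γ j k i
  D_g : ∀ i, g.map (D i) = g * Γ i + (g * Γ i)ᵀ

/-- The curvature endomorphisms: the entry `(l, k)` of `curvMat D Γ i j` is `R^l_{ijk}`. -/
def curvMat (D : ι → Derivation ℝ A A) (Γ : ι → Matrix ι ι A) (i j : ι) : Matrix ι ι A :=
  (Γ j).map (D i) - (Γ i).map (D j) + (Γ i * Γ j - Γ j * Γ i)

/-- The Ricci tensor `Rc_{jk} = R^i_{ijk}`. -/
def ricMat (D : ι → Derivation ℝ A A) (Γ : ι → Matrix ι ι A) : Matrix ι ι A :=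
  Matrix.of fun j k => ∑ i, curvMat D Γ i j i k

/-- The divergence `∂_i V^i + Γ^j_{ji} V^i` of a vector field; the trace of `Γ i` is
`Γ^j_{ij} = Γ^j_{ji}`. -/
def divVec (D : ι → Derivation ℝ A A) (Γ : ι → Matrix ι ι A) (V : ι → A) : A :=
  ∑ i, (D i (V i) + (Γ i).trace * V i)

/-- The divergence `∇_l T^l_m` of a mixed tensor, with `T l m = T^l_m`. -/
def divMixed (D : ι → Derivation ℝ A A) (Γ : ι → Matrix ι ι A) (T : Matrix ι ι A) (m : ι) : A :=
  divVec D Γ (fun l => T l m) - (Γ m * T).trace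

section

variable {D : ι → Derivation ℝ A A} {g q : Matrix ι ι A} {Γ : ι → Matrix ι ι A}

lemma divVec_add (V W : ι → A) : divVec D Γ (fun i => V i + W i) = divVec D Γ V + divVec D Γ W := by
  simp only [divVec, ← Finset.sum_add_distrib, map_add]
  exact Finset.sum_congr rfl fun _ _ => by ring

lemma divVec_sub (V W : ι → A) : divVec D Γ (fun i => V i - W i) = divVec D Γ V - divVec D Γ W := by
  simp only [divVec, ← Finset.sum_sub_distrib, map_sub]
  exact Finset.sum_congr rfl fun _ _ => by ring

lemma divVec_smul (c : ℝ) (V : ι → A) : divVec D Γ (fun i => c • V i) = c • divVec D Γ V := by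
  simp only [divVec, Finset.smul_sum, Derivation.map_smul, mul_smul_comm, smul_add]

lemma two_cancel {a b : A} (h : 2 * a = 2 * b) : a = b := by
  have h2 : (algebraMap ℝ A (1/2)) * 2 = 1 := by
    have : (2 : A) = algebraMap ℝ A 2 := (map_ofNat (algebraMap ℝ A) 2).symm
    rw [this, ← map_mul]; norm_num
  calc a = (algebraMap ℝ A (1/2)) * 2 * a := by rw [h2, one_mul]
    _ = (algebraMap ℝ A (1/2)) * 2 * b := by rw [mul_assoc, h, mul_assoc]
    _ = b := by rw [h2, one_mul]

variable (hL : LeviCivita D g q Γ)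
include hL

namespace LeviCivita

lemma g_mul_q : g * q = 1 := mul_eq_one_comm.mp hL.q_mul_g

lemma D_q (i : ι) : q.map (D i) = -(Γ i * q) - (Γ i * q)ᵀ := by
  rw [map_inverse hL.q_mul_g, hL.D_g]
  simp only [Matrix.transpose_mul, hL.g_symm, hL.q_symm]
  have h1 : q * (g * Γ i + (Γ i)ᵀ * g) * q = (q * g) * Γ i * q + q * (Γ i)ᵀ * (g * q) := by
    noncomm_ring
  rw [h1, hL.q_mul_g, hL.g_mul_q]
  noncomm_ring

lemma q_apply_symm (i j : ι) : q i j = q j i := by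
  conv_lhs => rw [← hL.q_symm]
  rfl

lemma D_q_apply (i j k : ι) :
    D i (q j k) = -(∑ m, Γ i j m * q m k) - ∑ m, Γ i k m * q m j :=
  congrFun (congrFun (hL.D_q i) j) k

lemma two_trace (i : ι) : 2 * (Γ i).trace = (q * g.map (D i)).trace := by
  rw [hL.D_g, mul_add, Matrix.trace_add, ← mul_assoc, hL.q_mul_g, one_mul, Matrix.transpose_mul,
    hL.g_symm, Matrix.trace_mul_comm, mul_assoc, hL.g_mul_q, mul_one, Matrix.trace_transpose]
  ring

lemma two_variation_trace {δ : Derivation ℝ A A} (i : ι) (h : ∀ a, δ (D i a) = D i (δ a)) :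
    2 * δ (Γ i).trace = D i (q * g.map δ).trace := by
  rw [← trace_variation_comm hL.q_mul_g h, ← hL.two_trace, Derivation.leibniz]
  have : δ (2 : A) = 0 := by simpa using δ.map_natCast 2
  simp [this]

lemma D_trace_comm (i j : ι) : D j (Γ i).trace = D i (Γ j).trace := by
  apply two_cancel
  rw [hL.two_variation_trace i (hL.comm j i), ← hL.two_trace, Derivation.leibniz]
  have : D i (2 : A) = 0 := by simpa using (D i).map_natCast 2
  simp [this]

lemma trace_eq (i : ι) : ∑ j, Γ j j i = (Γ i).trace :=
  Finset.sum_congr rfl fun j _ => hL.Γ_symm j j i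

lemma q_contract_Γ (a : ι) :
    ∑ j, ∑ k, q j k * Γ j a k = -(∑ l, D l (q l a)) - ∑ l, q a l * (Γ l).trace := by
  have h1 : ∑ l, ∑ m, Γ l l m * q m a = ∑ l, q a l * (Γ l).trace := by
    rw [Finset.sum_comm]
    refine Finset.sum_congr rfl fun m _ => ?_
    rw [← Finset.sum_mul, hL.trace_eq, hL.q_apply_symm, mul_comm]
  have h2 : ∑ l, ∑ m, Γ l a m * q m l = ∑ j, ∑ k, q j k * Γ j a k :=
    Finset.sum_congr rfl fun l _ => Finset.sum_congr rfl fun m _ => by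
      rw [hL.q_apply_symm, mul_comm]
  simp only [hL.D_q_apply, Finset.sum_sub_distrib, Finset.sum_neg_distrib, h1, h2]
  ring

lemma ricMat_eq (j k : ι) : ricMat D Γ j k = ∑ i, D i (Γ j i k) - D j (Γ k).trace
    + ∑ m, (Γ m).trace * Γ j m k - (Γ j * Γ k).trace := by
  have h1 : ∑ i, ∑ m, Γ i i m * Γ j m k = ∑ m, (Γ m).trace * Γ j m k := by
    rw [Finset.sum_comm]
    refine Finset.sum_congr rfl fun m _ => ?_
    rw [← Finset.sum_mul, hL.trace_eq]
  have h2 : ∑ i, ∑ m, Γ j i m * Γ i m k = (Γ j * Γ k).trace := by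
    simp only [Matrix.trace, Matrix.diag, Matrix.mul_apply]
    exact Finset.sum_congr rfl fun i _ => Finset.sum_congr rfl fun m _ => by
      rw [hL.Γ_symm i m k]
  have h3 : ∑ i, D j (Γ i i k) = D j (Γ k).trace := by
    rw [← map_sum, hL.trace_eq]
  simp only [ricMat, curvMat, Matrix.of_apply, Matrix.add_apply, Matrix.sub_apply, Matrix.map_apply,
    Matrix.mul_apply, Finset.sum_add_distrib, Finset.sum_sub_distrib, h1, h2, h3]
  ring

lemma ricMat_symm : (ricMat D Γ)ᵀ = ricMat D Γ := by
  ext j k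
  simp only [Matrix.transpose_apply, hL.ricMat_eq, hL.D_trace_comm j k, Matrix.trace_mul_comm (Γ k),
    hL.Γ_symm k _ j]

lemma curvMat_mul_q (i j : ι) : (curvMat D Γ i j * q)ᵀ = -(curvMat D Γ i j * q) := by
  have h1 := map_map_comm (hL.comm i j) q
  simp only [hL.D_q, map_sub_derivation, map_neg_derivation, Matrix.transpose_mul, hL.q_symm,
    map_mul_derivation, Matrix.transpose_map] at h1
  simp only [curvMat, Matrix.transpose_mul, Matrix.transpose_sub, Matrix.transpose_add, hL.q_symm]
  rw [eq_neg_iff_add_eq_zero]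
  rw [← sub_eq_zero] at h1
  rw [← h1]
  noncomm_ring

omit hL in
lemma curvMat_antisymm (i j : ι) : curvMat D Γ i j = -curvMat D Γ j i := by
  simp only [curvMat]; abel

/-- The second Bianchi identity. The Christoffel terms for the form indices `l, j, m` are absent:
they cancel in the cyclic sum since the connection is torsion free. -/
lemma second_bianchi (l j m : ι) :
    ((curvMat D Γ j m).map (D l) + Γ l * curvMat D Γ j m - curvMat D Γ j m * Γ l)
    + ((curvMat D Γ m l).map (D j) + Γ j * curvMat D Γ m l - curvMat D Γ m l * Γ j)
    + ((curvMat D Γ l j).map (D m) + Γ m * curvMat D Γ l j - curvMat D Γ l j * Γ m) = 0 := by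
  simp only [curvMat, map_sub_derivation, map_add_derivation, map_mul_derivation]
  rw [map_map_comm (hL.comm j l) (Γ m), map_map_comm (hL.comm m l) (Γ j),
    map_map_comm (hL.comm m j) (Γ l)]
  noncomm_ring

lemma second_bianchi_q (l j m : ι) :
    ((curvMat D Γ j m * q).map (D l) + Γ l * (curvMat D Γ j m * q) + curvMat D Γ j m * q * (Γ l)ᵀ)
    + ((curvMat D Γ m l * q).map (D j) + Γ j * (curvMat D Γ m l * q) + curvMat D Γ m l * q * (Γ j)ᵀ)
    + ((curvMat D Γ l j * q).map (D m) + Γ m * (curvMat D Γ l j * q) + curvMat D Γ l j * q * (Γ m)ᵀ)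
      = 0 := by
  have := congrArg (· * q) (hL.second_bianchi l j m)
  simp only [zero_mul] at this
  rw [← this]
  simp only [map_mul_derivation, hL.D_q, Matrix.transpose_mul, hL.q_symm]
  noncomm_ring

omit hL in
lemma sum_antisymm_mul_symm {Q B : ι → ι → A} (hQ : ∀ i j, Q i j = -Q j i)
    (hB : ∀ i j, B i j = B j i) : ∑ i, ∑ j, Q i j * B i j = 0 := by
  apply two_cancel
  have : ∑ i, ∑ j, Q i j * B i j = -∑ i, ∑ j, Q i j * B i j := by
    conv_lhs => rw [Finset.sum_comm]
    simp only [← Finset.sum_neg_distrib]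
    exact Finset.sum_congr rfl fun i _ => Finset.sum_congr rfl fun j _ => by
      rw [hQ, hB]; ring
  linear_combination this

lemma curvMat_mul_q_apply (i j a b : ι) :
    (curvMat D Γ i j * q) a b = -(curvMat D Γ i j * q) b a := by
  have := congrFun (congrFun (hL.curvMat_mul_q i j) b) a
  simpa using this

omit hL in
lemma curvMat_mul_q_antisymm (i j a b : ι) :
    (curvMat D Γ i j * q) a b = -(curvMat D Γ j i * q) a b := by
  rw [curvMat_antisymm, neg_mul]; rfl

lemma sum_curvMat_mul_q (l m : ι) : ∑ j, (curvMat D Γ j m * q) j l = (q * ricMat D Γ) l m := by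
  simp only [Matrix.mul_apply, ricMat, Matrix.of_apply]
  rw [Finset.sum_comm]
  refine Finset.sum_congr rfl fun k _ => ?_
  have := congrFun (congrFun hL.ricMat_symm k) m
  simp only [Matrix.transpose_apply, ricMat, Matrix.of_apply] at this
  rw [← this, Finset.mul_sum]
  exact Finset.sum_congr rfl fun i _ => by rw [hL.q_apply_symm k l, mul_comm]

/-- The contracted second Bianchi identity `div Rc = ½ dR`. It is the contraction of the cyclic
identity for `Q_{jm} = R_{jm} q`, which is antisymmetric in both pairs of indices; the Christoffel
terms in which an antisymmetric pair meets the lower indices of `Γ` vanish. -/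
lemma contracted_bianchi (m : ι) :
    2 * divMixed D Γ (q * ricMat D Γ) m = D m (q * ricMat D Γ).trace := by
  set E := q * ricMat D Γ with hE
  set Q : ι → ι → Matrix ι ι A := fun i j => curvMat D Γ i j * q with hQ
  have hQ1 : ∀ i j a b, Q i j a b = -Q i j b a := hL.curvMat_mul_q_apply
  have hQ2 : ∀ i j a b, Q i j a b = -Q j i a b := curvMat_mul_q_antisymm
  have hQE : ∀ l m, ∑ j, Q j m j l = E l m := hL.sum_curvMat_mul_q
  have hB : ∀ l j, _ := fun l j =>
    congrFun (congrFun (hL.second_bianchi_q l j m) l) j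
  have hsum := Finset.sum_eq_zero fun l (_ : l ∈ Finset.univ) =>
    Finset.sum_eq_zero fun j (_ : j ∈ Finset.univ) => hB l j
  simp only [Matrix.add_apply, Matrix.map_apply, Matrix.mul_apply (M := Γ _),
    Matrix.mul_apply (N := (Γ _)ᵀ), Matrix.transpose_apply, Finset.sum_add_distrib] at hsum
  change ∑ l, ∑ j, D l (Q j m l j) + ∑ l, ∑ j, ∑ a, Γ l l a * Q j m a j
    + ∑ l, ∑ j, ∑ a, Q j m l a * Γ l j a
    + (∑ l, ∑ j, D j (Q m l l j) + ∑ l, ∑ j, ∑ a, Γ j l a * Q m l a j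
      + ∑ l, ∑ j, ∑ a, Q m l l a * Γ j j a)
    + (∑ l, ∑ j, D m (Q l j l j) + ∑ l, ∑ j, ∑ a, Γ m l a * Q l j a j
      + ∑ l, ∑ j, ∑ a, Q l j l a * Γ m j a) = 0 at hsum
  have h1 : ∑ l, ∑ j, D l (Q j m l j) = -∑ l, D l (E l m) := by
    rw [← Finset.sum_neg_distrib]
    refine Finset.sum_congr rfl fun l _ => ?_
    rw [← map_sum, ← map_neg, ← hQE, ← Finset.sum_neg_distrib]
    exact congrArg _ (Finset.sum_congr rfl fun j _ => hQ1 _ _ _ _)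
  have h2 : ∑ l, ∑ j, ∑ a, Γ l l a * Q j m a j = -∑ a, (Γ a).trace * E a m := by
    rw [← Finset.sum_neg_distrib, Finset.sum_congr rfl fun l _ => Finset.sum_comm,
      Finset.sum_comm]
    refine Finset.sum_congr rfl fun a _ => ?_
    rw [← hL.trace_eq, ← hQE, Finset.sum_mul, ← Finset.sum_neg_distrib]
    refine Finset.sum_congr rfl fun l _ => ?_
    rw [← Finset.mul_sum, ← mul_neg, ← Finset.sum_neg_distrib]
    exact congrArg _ (Finset.sum_congr rfl fun j _ => hQ1 _ _ _ _)
  have h3 : ∑ l, ∑ j, ∑ a, Q j m l a * Γ l j a = 0 := by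
    rw [Finset.sum_comm]
    refine Finset.sum_eq_zero fun j _ => ?_
    refine sum_antisymm_mul_symm (fun a b => hQ1 _ _ _ _) (fun a b => ?_)
    rw [hL.Γ_symm]
  have h4 : ∑ l, ∑ j, D j (Q m l l j) = -∑ l, D l (E l m) := by
    rw [← Finset.sum_neg_distrib, Finset.sum_comm]
    refine Finset.sum_congr rfl fun j _ => ?_
    rw [← map_sum, ← map_neg, ← hQE, ← Finset.sum_neg_distrib]
    exact congrArg _ (Finset.sum_congr rfl fun l _ => hQ2 _ _ _ _)
  have h5 : ∑ l, ∑ j, ∑ a, Γ j l a * Q m l a j = 0 := by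
    refine Finset.sum_eq_zero fun l _ => ?_
    rw [Finset.sum_comm]
    simp only [mul_comm (Γ _ _ _)]
    refine sum_antisymm_mul_symm (fun a b => hQ1 _ _ _ _) (fun a b => ?_)
    rw [hL.Γ_symm]
  have h6 : ∑ l, ∑ j, ∑ a, Q m l l a * Γ j j a = -∑ a, (Γ a).trace * E a m := by
    rw [← Finset.sum_neg_distrib, Finset.sum_congr rfl fun l _ => Finset.sum_comm,
      Finset.sum_comm]
    refine Finset.sum_congr rfl fun a _ => ?_
    simp only [← Finset.mul_sum, hL.trace_eq]
    rw [← Finset.sum_mul, ← hQE, mul_comm, ← mul_neg, ← Finset.sum_neg_distrib]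
    exact congrArg _ (Finset.sum_congr rfl fun l _ => hQ2 _ _ _ _)
  have h7 : ∑ l, ∑ j, D m (Q l j l j) = D m E.trace := by
    rw [Finset.sum_comm, Matrix.trace, map_sum]
    refine Finset.sum_congr rfl fun j _ => ?_
    rw [← map_sum, hQE]; rfl
  have h8 : ∑ l, ∑ j, ∑ a, Γ m l a * Q l j a j = (Γ m * E).trace := by
    simp only [Matrix.trace, Matrix.diag, Matrix.mul_apply]
    refine Finset.sum_congr rfl fun l _ => ?_
    rw [Finset.sum_comm]
    refine Finset.sum_congr rfl fun a _ => ?_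
    rw [← hQE, Finset.mul_sum]
    refine Finset.sum_congr rfl fun j _ => ?_
    rw [hQ1, hQ2, neg_neg]
  have h9 : ∑ l, ∑ j, ∑ a, Q l j l a * Γ m j a = (Γ m * E).trace := by
    simp only [Matrix.trace, Matrix.diag, Matrix.mul_apply]
    rw [Finset.sum_comm]
    refine Finset.sum_congr rfl fun j _ => ?_
    rw [Finset.sum_comm]
    refine Finset.sum_congr rfl fun a _ => ?_
    rw [← hQE, ← Finset.sum_mul, mul_comm]
  rw [h1, h2, h3, h4, h5, h6, h7, h8, h9] at hsum
  simp only [divMixed, divVec, Finset.sum_add_distrib]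
  linear_combination -hsum

end LeviCivita
end

end

/-! ### Gradient, Hessian and the weighted contracted Bianchi identity -/

section

variable {A : Type*} [CommRing A] [Algebra ℝ A] {ι : Type*} [Fintype ι] [DecidableEq ι]

/-- The gradient `(∇f)^l = g^{lk} ∂_k f`. -/
def gradVec (D : ι → Derivation ℝ A A) (q : Matrix ι ι A) (f : A) (l : ι) : A :=
  ∑ k, q l k * D k f

/-- The Hessian `∇_i ∂_j f`. -/
def hessMat (D : ι → Derivation ℝ A A) (Γ : ι → Matrix ι ι A) (f : A) : Matrix ι ι A :=
  Matrix.of fun i j => D i (D j f) - ∑ k, Γ i k j * D k f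

variable {D : ι → Derivation ℝ A A} {g q : Matrix ι ι A} {Γ : ι → Matrix ι ι A}

namespace LeviCivita

variable (hL : LeviCivita D g q Γ)
include hL

lemma sum_D_mul_gradVec (a f : A) : ∑ l, D l a * gradVec D q f l = ∑ l, D l f * gradVec D q a l := by
  simp only [gradVec, Finset.mul_sum]
  rw [Finset.sum_comm]
  refine Finset.sum_congr rfl fun j _ => Finset.sum_congr rfl fun l _ => ?_
  rw [hL.q_apply_symm]; ring

lemma hessMat_symm (f : A) (i j : ι) : hessMat D Γ f i j = hessMat D Γ f j i := by
  simp only [hessMat, Matrix.of_apply, hL.comm i j, hL.Γ_symm i _ j]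

lemma q_mul_hessMat (f : A) (l m : ι) :
    (q * hessMat D Γ f) l m = D m (gradVec D q f l) + ∑ a, Γ m l a * gradVec D q f a := by
  have h1 : ∑ k, (∑ a, Γ m l a * q a k) * D k f = ∑ a, Γ m l a * gradVec D q f a := by
    simp only [gradVec, Finset.sum_mul, Finset.mul_sum]
    rw [Finset.sum_comm]
    simp only [mul_assoc]
  have h2 : ∑ k, (∑ a, Γ m k a * q a l) * D k f = ∑ a, q l a * ∑ k, Γ a k m * D k f := by
    simp only [Finset.sum_mul, Finset.mul_sum]
    rw [Finset.sum_comm]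
    refine Finset.sum_congr rfl fun a _ => Finset.sum_congr rfl fun k _ => ?_
    rw [hL.q_apply_symm l a, hL.Γ_symm m k a]; ring
  have h3 : D m (gradVec D q f l) = ∑ k, q l k * D k (D m f)
      - ∑ a, Γ m l a * gradVec D q f a - ∑ a, q l a * ∑ k, Γ a k m * D k f := by
    rw [← h1, ← h2]
    conv_lhs => rw [gradVec]
    simp only [map_sum, Derivation.leibniz, smul_eq_mul, hL.D_q_apply, ← Finset.sum_sub_distrib]
    refine Finset.sum_congr rfl fun k _ => ?_
    rw [hL.comm m k]; ring
  rw [h3]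
  simp only [Matrix.mul_apply, hessMat, Matrix.of_apply, mul_sub, Finset.sum_sub_distrib]
  ring

lemma trace_q_mul_hessMat (f : A) : (q * hessMat D Γ f).trace = divVec D Γ (gradVec D q f) := by
  simp only [Matrix.trace, Matrix.diag, hL.q_mul_hessMat, divVec, Finset.sum_add_distrib]
  congr 1
  rw [Finset.sum_comm]
  refine Finset.sum_congr rfl fun a _ => ?_
  rw [← Finset.sum_mul]; congr 1
  exact hL.trace_eq a

/-- Bochner commutation `div ∇²f = dΔf + Rc(∇f)`. -/
lemma divMixed_hessMat (f : A) (m : ι) :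
    divMixed D Γ (q * hessMat D Γ f) m
      = D m (divVec D Γ (gradVec D q f)) + ∑ l, (q * ricMat D Γ) l m * D l f := by
  set u := gradVec D q f with hu
  have h1 : ∑ l, (q * ricMat D Γ) l m * D l f = ∑ a, ricMat D Γ m a * u a := by
    simp only [Matrix.mul_apply, hu, gradVec, Finset.sum_mul, Finset.mul_sum]
    rw [Finset.sum_comm]
    refine Finset.sum_congr rfl fun a _ => Finset.sum_congr rfl fun l _ => ?_
    have := congrFun (congrFun hL.ricMat_symm a) m
    rw [Matrix.transpose_apply] at this
    rw [this, hL.q_apply_symm]; ring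
  have h2 : (Γ m * (q * hessMat D Γ f)).trace
      = ∑ a, ∑ l, Γ m a l * D a (u l) + ∑ a, (Γ m * Γ a).trace * u a := by
    simp only [Matrix.trace, Matrix.diag, Matrix.mul_apply (M := Γ m), hL.q_mul_hessMat, mul_add,
      Finset.sum_add_distrib]
    congr 1
    simp only [Finset.mul_sum, Finset.sum_mul]
    rw [Finset.sum_congr rfl fun _ _ => Finset.sum_comm, Finset.sum_comm]
    refine Finset.sum_congr rfl fun a _ => Finset.sum_congr rfl fun l _ =>
      Finset.sum_congr rfl fun k _ => ?_
    rw [hL.Γ_symm l k a]; ring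
  have h4 : ∑ l, ∑ a, u a * D l (Γ m l a) = ∑ a, (∑ l, D l (Γ m l a)) * u a := by
    rw [Finset.sum_comm]
    simp only [Finset.sum_mul]
    exact Finset.sum_congr rfl fun a _ => Finset.sum_congr rfl fun l _ => mul_comm _ _
  have h5 : ∑ l, (Γ l).trace * ∑ a, Γ m l a * u a = ∑ a, (∑ l, (Γ l).trace * Γ m l a) * u a := by
    simp only [Finset.sum_mul, Finset.mul_sum]
    rw [Finset.sum_comm]
    simp only [mul_assoc]
  rw [h1, divMixed, h2]
  simp only [divVec, hL.q_mul_hessMat, ← hu, hL.ricMat_eq, map_sum, map_add, Derivation.leibniz, smul_eq_mul,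
    mul_add, Finset.sum_add_distrib, sub_mul, add_mul, Finset.sum_sub_distrib, h4, h5,
    hL.comm m]
  have h6 : ∑ l, u l * D m (Γ l).trace = ∑ l, D m (Γ l).trace * u l :=
    Finset.sum_congr rfl fun _ _ => mul_comm _ _
  rw [h6]
  ring

lemma D_grad_sq (f : A) (m : ι) :
    D m (∑ l, D l f * gradVec D q f l) = 2 * ∑ l, (q * hessMat D Γ f) l m * D l f := by
  set u := gradVec D q f with hu
  have h1 : ∑ l, (q * hessMat D Γ f) l m * D l f = ∑ a, hessMat D Γ f m a * u a := by
    simp only [Matrix.mul_apply, hu, gradVec, Finset.sum_mul, Finset.mul_sum]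
    rw [Finset.sum_comm]
    refine Finset.sum_congr rfl fun a _ => Finset.sum_congr rfl fun l _ => ?_
    rw [hL.hessMat_symm f a m, hL.q_apply_symm]; ring
  have h2 : ∑ l, (q * hessMat D Γ f) l m * D l f
      = ∑ l, D m (u l) * D l f + ∑ l, (∑ a, Γ m l a * u a) * D l f := by
    simp only [hL.q_mul_hessMat, add_mul, Finset.sum_add_distrib, hu]
  have h3 : ∑ a, hessMat D Γ f m a * u a
      = ∑ a, D m (D a f) * u a - ∑ l, (∑ a, Γ m l a * u a) * D l f := by
    simp only [hessMat, Matrix.of_apply, sub_mul, Finset.sum_sub_distrib, Finset.sum_mul]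
    congr 1
    rw [Finset.sum_comm]
    exact Finset.sum_congr rfl fun a _ => Finset.sum_congr rfl fun l _ => by ring
  have h4 : D m (∑ l, D l f * u l) = ∑ l, D m (u l) * D l f + ∑ a, D m (D a f) * u a := by
    rw [map_sum, ← Finset.sum_add_distrib]
    refine Finset.sum_congr rfl fun l _ => ?_
    rw [Derivation.leibniz, smul_eq_mul, smul_eq_mul]; ring
  rw [h4]
  linear_combination -h1 - h2 - h3

omit hL in
lemma divMixed_add (T U : Matrix ι ι A) (m : ι) : divMixed D Γ (T + U) m = divMixed D Γ T m + divMixed D Γ U m := by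
  simp only [divMixed, Matrix.add_apply, divVec_add, mul_add, Matrix.trace_add]; ring

/-- The weighted contracted Bianchi identity `div_f (Rc + ∇²f) = ½ d(R + 2Δf - |∇f|²)`. -/
lemma weighted_bianchi (f : A) (m : ι) :
    2 * (divMixed D Γ (q * ricMat D Γ + q * hessMat D Γ f) m
        - ∑ l, (q * ricMat D Γ + q * hessMat D Γ f) l m * D l f)
      = D m ((q * ricMat D Γ).trace + 2 * divVec D Γ (gradVec D q f) - ∑ l, D l f * gradVec D q f l) := by
  have h2 : D m (2 * divVec D Γ (gradVec D q f)) = 2 * D m (divVec D Γ (gradVec D q f)) := by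
    rw [two_mul, map_add]; ring
  simp only [map_sub, map_add, h2, hL.D_grad_sq, ← hL.contracted_bianchi, divMixed_add, hL.divMixed_hessMat,
    Matrix.add_apply, add_mul, Finset.sum_add_distrib]
  ring

/-- The divergence of a mixed tensor, with the index raised. -/
lemma raise_divMixed {T : Matrix ι ι A} (i : ι) :
    ∑ j, q i j * divMixed D Γ T j = ∑ l, (D l ((T * q) l i) + (Γ l).trace * (T * q) l i)
      + ∑ j, ∑ k, Γ j i k * (T * q) j k := by
  have h1 : ∑ l, D l ((T * q) l i) = ∑ j, q i j * (∑ l, D l (T l j))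
      - ∑ l, ∑ j, T l j * (∑ m, Γ l j m * q m i) - ∑ l, ∑ j, T l j * (∑ m, Γ l i m * q m j) := by
    have : ∑ j, q i j * (∑ l, D l (T l j)) = ∑ l, ∑ j, q i j * D l (T l j) := by
      simp only [Finset.mul_sum]; rw [Finset.sum_comm]
    rw [this]
    simp only [Matrix.mul_apply, map_sum, Derivation.leibniz, smul_eq_mul,
      ← Finset.sum_sub_distrib, hL.D_q_apply]
    refine Finset.sum_congr rfl fun l _ => Finset.sum_congr rfl fun j _ => ?_
    rw [hL.q_apply_symm i j]; ring
  have h2 : ∑ l, (Γ l).trace * (T * q) l i = ∑ j, q i j * ∑ l, (Γ l).trace * T l j := by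
    simp only [Matrix.mul_apply, Finset.mul_sum]
    rw [Finset.sum_comm]
    refine Finset.sum_congr rfl fun l _ => Finset.sum_congr rfl fun j _ => ?_
    rw [hL.q_apply_symm i]; ring
  have h3 : ∑ l, ∑ j, T l j * (∑ m, Γ l j m * q m i) = ∑ j, q i j * (Γ j * T).trace := by
    simp only [Matrix.trace, Matrix.diag, Matrix.mul_apply, Finset.mul_sum]
    rw [Finset.sum_congr rfl fun _ _ => Finset.sum_comm, Finset.sum_comm]
    refine Finset.sum_congr rfl fun m _ => ?_
    rw [Finset.sum_comm]
    refine Finset.sum_congr rfl fun j _ => Finset.sum_congr rfl fun l _ => ?_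
    rw [hL.q_apply_symm i, hL.Γ_symm l j m]; ring
  have h4 : ∑ l, ∑ j, T l j * (∑ m, Γ l i m * q m j) = ∑ j, ∑ k, Γ j i k * (T * q) j k := by
    refine Finset.sum_congr rfl fun l _ => ?_
    simp only [Matrix.mul_apply, Finset.mul_sum]
    rw [Finset.sum_comm]
    refine Finset.sum_congr rfl fun m _ => Finset.sum_congr rfl fun j _ => ?_
    rw [hL.q_apply_symm m j]; ring
  simp only [divMixed, divVec, mul_sub, Finset.sum_sub_distrib, Finset.sum_add_distrib, mul_add]
  rw [h1, h2, h3, h4]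
  ring

lemma divVec_mixed_apply (T : Matrix ι ι A) (f : A) :
    divVec D Γ (fun l => ∑ j, T l j * gradVec D q f j)
      = ∑ j, divMixed D Γ T j * gradVec D q f j + (T * (q * hessMat D Γ f)).trace := by
  set u := gradVec D q f with hu
  have h1 : (T * (q * hessMat D Γ f)).trace
      = ∑ l, ∑ j, T l j * D l (u j) + ∑ j, (Γ j * T).trace * u j := by
    simp only [Matrix.trace, Matrix.diag, Matrix.mul_apply (M := T), hL.q_mul_hessMat, mul_add,
      Finset.sum_add_distrib, Matrix.mul_apply (N := T)]
    congr 1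
    simp only [Finset.mul_sum, Finset.sum_mul]
    rw [Finset.sum_congr rfl fun _ _ => Finset.sum_comm, Finset.sum_comm]
    refine Finset.sum_congr rfl fun a _ => ?_
    rw [Finset.sum_comm]
    refine Finset.sum_congr rfl fun l _ =>
      Finset.sum_congr rfl fun k _ => ?_
    rw [hL.Γ_symm k l a]; ring
  have h2 : ∑ l, D l (∑ j, T l j * u j)
      = ∑ l, ∑ j, T l j * D l (u j) + ∑ j, (∑ l, D l (T l j)) * u j := by
    simp only [Finset.sum_mul]
    rw [Finset.sum_comm (f := fun j l => D l (T l j) * u j), ← Finset.sum_add_distrib]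
    refine Finset.sum_congr rfl fun l _ => ?_
    rw [map_sum, ← Finset.sum_add_distrib]
    refine Finset.sum_congr rfl fun j _ => ?_
    rw [Derivation.leibniz, smul_eq_mul, smul_eq_mul]; ring
  have h3 : ∑ l, (Γ l).trace * ∑ j, T l j * u j = ∑ j, (∑ l, (Γ l).trace * T l j) * u j := by
    simp only [Finset.sum_mul, Finset.mul_sum]
    rw [Finset.sum_comm]
    simp only [mul_assoc]
  rw [h1]
  simp only [divVec, divMixed, Finset.sum_add_distrib, h2, h3, sub_mul, Finset.sum_sub_distrib, add_mul]
  ring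

lemma divVec_raise (β : ι → A) : divVec D Γ (fun i => ∑ k, q i k * β k)
    = ∑ j, ∑ k, q j k * D j (β k) - ∑ m, (∑ j, ∑ k, q j k * Γ j m k) * β m := by
  have h1 : ∑ i, D i (∑ k, q i k * β k)
      = ∑ j, ∑ k, q j k * D j (β k) + ∑ k, (∑ l, D l (q l k)) * β k := by
    simp only [Finset.sum_mul]
    rw [Finset.sum_comm (f := fun k l => D l (q l k) * β k), ← Finset.sum_add_distrib]
    refine Finset.sum_congr rfl fun l _ => ?_
    rw [map_sum, ← Finset.sum_add_distrib]
    refine Finset.sum_congr rfl fun j _ => ?_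
    rw [Derivation.leibniz, smul_eq_mul, smul_eq_mul]; ring
  have h2 : ∑ i, (Γ i).trace * ∑ k, q i k * β k = ∑ k, (∑ l, q k l * (Γ l).trace) * β k := by
    simp only [Finset.sum_mul, Finset.mul_sum]
    rw [Finset.sum_comm]
    refine Finset.sum_congr rfl fun l _ => Finset.sum_congr rfl fun j _ => ?_
    rw [hL.q_apply_symm l]; ring
  simp only [divVec, Finset.sum_add_distrib, h1, h2, hL.q_contract_Γ, sub_mul, neg_mul,
    Finset.sum_sub_distrib, Finset.sum_neg_distrib]
  ring

/-! ### First variation of the weighted scalar curvature -/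

section Variation

variable {δ : Derivation ℝ A A} (hδ : ∀ i a, δ (D i a) = D i (δ a))
include hδ

omit hL in
lemma variation_divVec (V : ι → A) :
    δ (divVec D Γ V) = divVec D Γ (fun i => δ (V i)) + ∑ i, δ (Γ i).trace * V i := by
  simp only [divVec, map_sum, ← Finset.sum_add_distrib]
  refine Finset.sum_congr rfl fun i _ => ?_
  rw [map_add, hδ, Derivation.leibniz, smul_eq_mul, smul_eq_mul]; ring

/-- The trace of the variation of the Ricci tensor is a divergence (Palatini identity); `δΓ` is not
expressed through `δg` here. -/
lemma trace_variation_ricMat :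
    ∑ j, ∑ k, q j k * δ (ricMat D Γ j k)
      = divVec D Γ (fun i => ∑ j, ∑ k, q j k * δ (Γ j i k))
        - divVec D Γ (fun i => ∑ k, q i k * δ (Γ k).trace) := by
  have hΓ' : ∀ i k j, δ (Γ i k j) = δ (Γ j k i) := fun i k j => by rw [hL.Γ_symm]
  -- the terms quadratic in the connection, which cancel against the derivatives of `q`
  set X := ∑ j, ∑ k, q j k * ((Γ j).map δ * Γ k).trace with hX
  have hX' : ∑ j, ∑ k, q j k * (Γ j * (Γ k).map δ).trace = X := by
    rw [hX, Finset.sum_comm]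
    refine Finset.sum_congr rfl fun j _ => Finset.sum_congr rfl fun k _ => ?_
    rw [Matrix.trace_mul_comm, hL.q_apply_symm]
  have h1 : ∑ i, ∑ j, ∑ k, (∑ a, Γ i k a * q a j) * δ (Γ j i k) = X := by
    rw [hX, Finset.sum_comm]
    refine Finset.sum_congr rfl fun j _ => ?_
    simp only [Matrix.trace, Matrix.diag, Matrix.mul_apply, Matrix.map_apply, Finset.mul_sum,
      Finset.sum_mul]
    rw [Finset.sum_comm (s := Finset.univ) (t := Finset.univ)
      (f := fun k i => ∑ a, q j k * (δ (Γ j i a) * Γ k a i))]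
    refine Finset.sum_congr rfl fun i _ => ?_
    rw [Finset.sum_comm]
    refine Finset.sum_congr rfl fun a _ => Finset.sum_congr rfl fun k _ => ?_
    rw [hL.Γ_symm i k a, hL.q_apply_symm]; ring
  have h2 : ∑ i, ∑ j, ∑ k, (∑ a, Γ i j a * q a k) * δ (Γ j i k) = X := by
    rw [← h1]
    refine Finset.sum_congr rfl fun i _ => ?_
    rw [Finset.sum_comm]
    refine Finset.sum_congr rfl fun a _ => Finset.sum_congr rfl fun k _ => ?_
    rw [hΓ']
  have h3 : ∑ i, D i (∑ j, ∑ k, q j k * δ (Γ j i k))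
      = ∑ j, ∑ k, q j k * ∑ i, D i (δ (Γ j i k)) - 2 * X := by
    have : ∑ j, ∑ k, q j k * ∑ i, D i (δ (Γ j i k))
        = ∑ i, ∑ j, ∑ k, q j k * D i (δ (Γ j i k)) := by
      simp only [Finset.mul_sum]
      rw [Finset.sum_congr rfl fun _ _ => Finset.sum_comm, Finset.sum_comm]
    rw [this, two_mul]
    nth_rw 1 [← h1]
    rw [← h2]
    simp only [map_sum, Derivation.leibniz, smul_eq_mul, ← Finset.sum_sub_distrib,
      ← Finset.sum_add_distrib, hL.D_q_apply]
    refine Finset.sum_congr rfl fun i _ => Finset.sum_congr rfl fun j _ =>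
      Finset.sum_congr rfl fun k _ => ?_
    ring
  have h4 : ∑ i, (Γ i).trace * ∑ j, ∑ k, q j k * δ (Γ j i k)
      = ∑ j, ∑ k, q j k * ∑ m, (Γ m).trace * δ (Γ j m k) := by
    simp only [Finset.mul_sum]
    rw [Finset.sum_comm]
    refine Finset.sum_congr rfl fun j _ => ?_
    rw [Finset.sum_comm]
    exact Finset.sum_congr rfl fun k _ => Finset.sum_congr rfl fun i _ => by ring
  have h5 : ∑ m, (∑ j, ∑ k, q j k * Γ j m k) * δ (Γ m).trace
      = ∑ j, ∑ k, q j k * ∑ m, δ (Γ m).trace * Γ j m k := by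
    simp only [Finset.mul_sum, Finset.sum_mul]
    rw [Finset.sum_comm]
    refine Finset.sum_congr rfl fun j _ => ?_
    rw [Finset.sum_comm]
    exact Finset.sum_congr rfl fun k _ => Finset.sum_congr rfl fun i _ => by ring
  have h6 : ∀ j k, δ (ricMat D Γ j k) = ∑ i, D i (δ (Γ j i k)) - D j (δ (Γ k).trace)
      + (∑ m, (Γ m).trace * δ (Γ j m k) + ∑ m, δ (Γ m).trace * Γ j m k)
      - (((Γ j).map δ * Γ k).trace + (Γ j * (Γ k).map δ).trace) := by
    intro j k
    have key : ∀ M : Matrix ι ι A, δ M.trace = (M.map δ).trace := by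
      intro M; simp [Matrix.trace]
    rw [hL.ricMat_eq, map_sub, key (Γ j * Γ k), map_mul_derivation, Matrix.trace_add, map_add,
      map_sub, hδ, map_sum, map_sum, ← Finset.sum_add_distrib]
    simp only [hδ, Derivation.leibniz, smul_eq_mul]
    congr 2
    exact Finset.sum_congr rfl fun m _ => by ring
  rw [hL.divVec_raise]
  simp only [h6, mul_add, mul_sub, Finset.sum_add_distrib, Finset.sum_sub_distrib, hX', h5, ← h4,
    ← hX]
  simp only [divVec, Finset.sum_add_distrib, h3]
  ring

lemma sum_variation_Γ (i : ι) :
    ∑ j, ∑ k, q j k * δ (Γ j i k)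
      = -(∑ l, (D l (δ (q l i)) + (Γ l).trace * δ (q l i)) + ∑ j, ∑ k, Γ j i k * δ (q j k))
        - ∑ k, q i k * δ (Γ k).trace := by
  have h1 := congrArg δ (hL.q_contract_Γ i)
  simp only [map_sum, map_sub, map_neg, Derivation.leibniz, smul_eq_mul, Finset.sum_add_distrib,
    hδ] at h1
  have h2 : ∑ l, (Γ l).trace * δ (q l i) = ∑ l, (Γ l).trace * δ (q i l) :=
    Finset.sum_congr rfl fun l _ => by rw [hL.q_apply_symm]
  rw [Finset.sum_add_distrib, h2]
  linear_combination h1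

lemma variation_trace_Γ {T : Matrix ι ι A} (hT : q.map δ = (2 : ℝ) • (T * q)) (i : ι) :
    δ (Γ i).trace = -D i T.trace := by
  apply two_cancel
  rw [hL.two_variation_trace i (hδ i)]
  have h1 : q.map δ * g = (2 : ℝ) • T := by
    rw [hT, smul_mul_assoc, mul_assoc, hL.q_mul_g, mul_one]
  have h2 : q * g.map δ = -((2 : ℝ) • T) := by
    have h3 := map_inverse hL.q_mul_g δ
    rw [← h1, h3, neg_mul, neg_neg, mul_assoc _ q g, hL.q_mul_g, mul_one]
  rw [h2, Matrix.trace_neg, Matrix.trace_smul, map_neg, Derivation.map_smul, ofNat_smul_eq_nsmul,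
    nsmul_eq_mul]
  push_cast; ring

/-- The first variation of the scalar curvature, for `δg = -2S` and `T = q S` the mixed form of `S`:
`δR = 2⟨S, Rc⟩ - 2 div div S + 2 Δ tr S`. The hypothesis is the equivalent `δ(g⁻¹) = 2 g⁻¹ S g⁻¹`. -/
lemma variation_scal {T : Matrix ι ι A} (hT : q.map δ = (2 : ℝ) • (T * q)) :
    δ (q * ricMat D Γ).trace = 2 * (T * (q * ricMat D Γ)).trace
      - 2 * divVec D Γ (fun i => ∑ j, q i j * divMixed D Γ T j) + 2 * divVec D Γ (gradVec D q T.trace) := by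
  have hT' : ∀ i j, δ (q i j) = (2 : ℝ) • (T * q) i j := fun i j => congrFun (congrFun hT i) j
  have htr := hL.variation_trace_Γ hδ hT
  have h1 : (fun i => ∑ j, ∑ k, q j k * δ (Γ j i k))
      = fun i => (-2 : ℝ) • (∑ j, q i j * divMixed D Γ T j) - (-1 : ℝ) • gradVec D q T.trace i := by
    funext i
    rw [hL.sum_variation_Γ hδ, hL.raise_divMixed]
    simp only [htr, gradVec, hT', Derivation.map_smul, Finset.sum_add_distrib,
      mul_smul_comm, mul_neg, Finset.sum_neg_distrib, ← Finset.smul_sum]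
    module
  have h2 : (fun i => ∑ k, q i k * δ (Γ k).trace) = fun i => (-1 : ℝ) • gradVec D q T.trace i := by
    funext i
    simp [htr, gradVec]
  have h3 : δ (q * ricMat D Γ).trace = ∑ j, ∑ k, q j k * δ (ricMat D Γ j k)
      + (q.map δ * ricMat D Γ).trace := by
    simp only [Matrix.trace, Matrix.diag, Matrix.mul_apply, map_sum, Derivation.leibniz,
      smul_eq_mul, ← Finset.sum_add_distrib, Matrix.map_apply]
    refine Finset.sum_congr rfl fun j _ => Finset.sum_congr rfl fun k _ => ?_
    have := congrFun (congrFun hL.ricMat_symm j) k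
    rw [Matrix.transpose_apply] at this
    rw [this]; ring
  rw [h3, hL.trace_variation_ricMat hδ, h1, h2, divVec_sub, divVec_smul, divVec_smul, hT, smul_mul_assoc,
    Matrix.trace_smul, mul_assoc]
  simp only [ofNat_smul_eq_nsmul, nsmul_eq_mul, neg_smul, one_smul]
  push_cast
  ring

/-- The variation of `R + 2Δf - |∇f|²` when `δg = -2S`, `δf = ρ - tr S` and
`div_f S = ½ dρ + ¼ κ`: it is `2⟨S, Rc + ∇²f⟩ + Δ_f ρ - ½ div_f κ`. -/
lemma variation_weighted_scal {T : Matrix ι ι A} (hT : q.map δ = (2 : ℝ) • (T * q))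
    (f ρ : A) (κ : ι → A) (hf : δ f = ρ - T.trace)
    (hB : ∀ m, 4 * (divMixed D Γ T m - ∑ l, T l m * D l f) = 2 * D m ρ + κ m) :
    2 * δ ((q * ricMat D Γ).trace + 2 * divVec D Γ (gradVec D q f) - ∑ l, D l f * gradVec D q f l)
      = 4 * (T * (q * ricMat D Γ + q * hessMat D Γ f)).trace + 2 * divVec D Γ (gradVec D q ρ)
        - 2 * ∑ l, D l f * gradVec D q ρ l
        - (divVec D Γ (fun i => ∑ j, q i j * κ j) - ∑ j, κ j * gradVec D q f j) := by
  set u := gradVec D q f with hu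
  have hT' : ∀ i j, δ (q i j) = 2 * (T * q) i j := fun i j => by
    have : δ (q i j) = (2 : ℝ) • (T * q) i j := congrFun (congrFun hT i) j
    rw [this, ofNat_smul_eq_nsmul, nsmul_eq_mul]; push_cast; rfl
  have hTsymm : ∀ i j, (T * q) i j = (T * q) j i := fun i j =>
    two_cancel (by rw [← hT', ← hT', hL.q_apply_symm])
  have hTu : ∀ l, ∑ k, (T * q) l k * D k f = ∑ j, T l j * u j := by
    intro l
    simp only [Matrix.mul_apply, hu, gradVec, Finset.sum_mul, Finset.mul_sum]
    rw [Finset.sum_comm]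
    simp only [mul_assoc]
  have hgrd : ∀ l, gradVec D q (δ f) l = gradVec D q ρ l - gradVec D q T.trace l := by
    intro l
    simp only [gradVec, hf, map_sub, mul_sub, Finset.sum_sub_distrib]
  have hδu : ∀ l, δ (u l)
      = (∑ j, T l j * u j + ∑ j, T l j * u j) + (gradVec D q ρ l - gradVec D q T.trace l) := by
    intro l
    rw [← hgrd, ← hTu]
    simp only [hu, gradVec, map_sum, Derivation.leibniz, smul_eq_mul, hδ, hT',
      ← Finset.sum_add_distrib]
    exact Finset.sum_congr rfl fun k _ => by ring
  have hraise : ∀ i, ∑ j, q i j * divMixed D Γ T j + ∑ j, q i j * divMixed D Γ T j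
      + (∑ j, q i j * divMixed D Γ T j + ∑ j, q i j * divMixed D Γ T j)
      = (∑ j, T i j * u j + ∑ j, T i j * u j + (∑ j, T i j * u j + ∑ j, T i j * u j))
        + (gradVec D q ρ i + gradVec D q ρ i) + ∑ j, q i j * κ j := by
    intro i
    have h1 : ∑ j, T i j * u j = ∑ j, q i j * ∑ l, T l j * D l f := by
      rw [← hTu]
      simp only [hTsymm i]
      simp only [Matrix.mul_apply, Finset.sum_mul, Finset.mul_sum]
      rw [Finset.sum_comm]
      refine Finset.sum_congr rfl fun j _ => Finset.sum_congr rfl fun l _ => ?_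
      rw [hL.q_apply_symm i j]; ring
    rw [h1]
    simp only [gradVec, ← Finset.sum_add_distrib]
    refine Finset.sum_congr rfl fun j _ => ?_
    linear_combination q i j * hB j
  have hdvraise : 4 * divVec D Γ (fun i => ∑ j, q i j * divMixed D Γ T j)
      = 4 * divVec D Γ (fun l => ∑ j, T l j * u j) + 2 * divVec D Γ (gradVec D q ρ)
        + divVec D Γ (fun i => ∑ j, q i j * κ j) := by
    have := congrArg (divVec D Γ) (funext hraise)
    simp only [divVec_add] at this
    linear_combination this
  have hswap : ∀ a, ∑ l, D l a * u l = ∑ l, D l f * gradVec D q a l :=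
    fun a => hL.sum_D_mul_gradVec a f
  have hmixed := hL.divVec_mixed_apply T f
  rw [← hu] at hmixed
  have hcontr : 4 * ∑ j, divMixed D Γ T j * u j = 4 * ∑ l, D l f * ∑ j, T l j * u j
      + 2 * (∑ l, D l f * gradVec D q ρ l) + ∑ j, κ j * u j := by
    have h1 : ∑ l, D l f * ∑ j, T l j * u j = ∑ j, (∑ l, T l j * D l f) * u j := by
      simp only [Finset.sum_mul, Finset.mul_sum]
      rw [Finset.sum_comm]
      exact Finset.sum_congr rfl fun j _ => Finset.sum_congr rfl fun l _ => by ring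
    rw [h1, ← hswap]
    simp only [Finset.mul_sum, ← Finset.sum_add_distrib]
    refine Finset.sum_congr rfl fun j _ => ?_
    linear_combination u j * hB j
  have hdvu : δ (divVec D Γ u) = 2 * divVec D Γ (fun l => ∑ j, T l j * u j)
      + (divVec D Γ (gradVec D q ρ) - divVec D Γ (gradVec D q T.trace)) - ∑ l, D l f * gradVec D q T.trace l := by
    rw [variation_divVec hδ, funext hδu, divVec_add, divVec_add, divVec_sub, ← hswap]
    simp only [hL.variation_trace_Γ hδ hT, neg_mul, Finset.sum_neg_distrib]
    ring
  have hgradsq : δ (∑ l, D l f * u l) = 2 * ∑ l, D l f * ∑ j, T l j * u j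
      + 2 * (∑ l, D l f * gradVec D q ρ l - ∑ l, D l f * gradVec D q T.trace l) := by
    have h1 : δ (∑ l, D l f * u l) = ∑ l, D l f * δ (u l) + ∑ l, D l (δ f) * u l := by
      rw [map_sum, ← Finset.sum_add_distrib]
      refine Finset.sum_congr rfl fun l _ => ?_
      rw [Derivation.leibniz, smul_eq_mul, smul_eq_mul, hδ]; ring
    rw [h1, hswap]
    simp only [hδu, hgrd, mul_add, mul_sub, Finset.sum_add_distrib, Finset.sum_sub_distrib]
    ring
  have h2 : δ (2 * divVec D Γ u) = 2 * δ (divVec D Γ u) := by rw [two_mul, map_add]; ring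
  rw [map_sub, map_add, h2, hgradsq, hdvu, hL.variation_scal hδ hT, mul_add T, Matrix.trace_add]
  linear_combination 4 * hmixed + hcontr - hdvraise

end Variation

end LeviCivita

end

/-! ### Alternating tensors and forms -/

section

variable {A : Type*} [CommRing A] [Algebra ℝ A] {ι : Type*} [Fintype ι] [DecidableEq ι]

/-- The components `H I` are those of an alternating form. -/
def IsAlt {k : ℕ} (H : (Fin k → ι) → A) : Prop :=
  ∀ (σ : Equiv.Perm (Fin k)) (I : Fin k → ι), H (I ∘ σ) = ((Equiv.Perm.sign σ : ℤ) : A) * H I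

/-- The components of a covariant tensor with all indices raised. -/
def raise {k : ℕ} (q : Matrix ι ι A) (T : (Fin k → ι) → A) (I : Fin k → ι) : A :=
  ∑ J, (∏ a, q (I a) (J a)) * T J

/-- The inner product of covariant tensors, all indices being summed. -/
def innProd {k : ℕ} (q : Matrix ι ι A) (S T : (Fin k → ι) → A) : A :=
  ∑ I, ∑ J, (∏ a, q (I a) (J a)) * S I * T J

/-- Insertion of the vector `X` into the first slot. -/
def insVec {k : ℕ} (X : ι → A) (T : (Fin (k + 1) → ι) → A) : (Fin k → ι) → A :=
  fun J => ∑ i, X i * T (Fin.cons i J)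

/-- The components of the covariant derivative `∇_l T`. -/
def nabla {k : ℕ} (D : ι → Derivation ℝ A A) (Γ : ι → Matrix ι ι A) (l : ι)
    (T : (Fin k → ι) → A) (I : Fin k → ι) : A :=
  D l (T I) - ∑ a, ∑ m, Γ l m (I a) * T (Function.update I a m)

/-- The exterior derivative, on components. -/
def dExt {k : ℕ} (D : ι → Derivation ℝ A A) (α : (Fin k → ι) → A) : (Fin (k + 1) → ι) → A :=
  fun I => ∑ a : Fin (k + 1), (-1 : A) ^ (a : ℕ) * D (I a) (α (a.removeNth I))

/-- The codifferential `(d^*α)_J = -g^{ij} (∇_i α)_{jJ}`. -/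
def codiff {k : ℕ} (D : ι → Derivation ℝ A A) (q : Matrix ι ι A) (Γ : ι → Matrix ι ι A)
    (α : (Fin (k + 1) → ι) → A) : (Fin k → ι) → A :=
  fun J => -∑ i, ∑ j, q i j * nabla D Γ i α (Fin.cons j J)

/-- The tensor `H²` of a homogeneous form, with components `⟨i_a H, i_b H⟩`. -/
def formSqLow {k : ℕ} (q : Matrix ι ι A) (H : (Fin (k + 1) → ι) → A) : Matrix ι ι A :=
  Matrix.of fun a b => innProd q (fun I => H (Fin.cons a I)) (fun I => H (Fin.cons b I))

section Basic

lemma derivation_prod {κ : Type*} [DecidableEq κ] (δ : Derivation ℝ A A) (s : Finset κ)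
    (f : κ → A) : δ (∏ a ∈ s, f a) = ∑ a ∈ s, δ (f a) * ∏ b ∈ s.erase a, f b := by
  induction s using Finset.induction_on with
  | empty => simp
  | insert c s hc ih =>
    rw [Finset.prod_insert hc, Finset.sum_insert hc, Finset.erase_insert hc, Derivation.leibniz,
      ih, smul_eq_mul, smul_eq_mul, Finset.mul_sum, add_comm, mul_comm (∏ a ∈ s, f a)]
    congr 1
    refine Finset.sum_congr rfl fun a ha => ?_
    have hac : c ≠ a := fun h => hc (h ▸ ha)
    rw [Finset.erase_insert_of_ne hac, Finset.prod_insert (by simp [hc])]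
    ring

lemma sum_cons {k : ℕ} (F : (Fin (k + 1) → ι) → A) :
    ∑ I, F I = ∑ i, ∑ I : Fin k → ι, F (Fin.cons i I) := by
  rw [← (Fin.consEquiv fun _ : Fin (k + 1) => ι).sum_comp, Fintype.sum_prod_type]
  rfl

lemma sum_insertNth {k : ℕ} (a : Fin (k + 1)) (F : (Fin (k + 1) → ι) → A) :
    ∑ I, F I = ∑ i, ∑ I : Fin k → ι, F (a.insertNth i I) := by
  rw [← (Fin.insertNthEquiv (fun _ : Fin (k + 1) => ι) a).sum_comp, Fintype.sum_prod_type]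
  rfl

lemma IsAlt.insertNth {k : ℕ} {H : (Fin (k + 1) → ι) → A} (hH : IsAlt H) (a : Fin (k + 1))
    (i : ι) (I : Fin k → ι) : H (a.insertNth i I) = (-1) ^ (a : ℕ) * H (Fin.cons i I) := by
  rw [← Fin.cons_comp_cycleRange, hH, Fin.sign_cycleRange]
  push_cast; rfl

lemma IsAlt.swap {k : ℕ} {H : (Fin k → ι) → A} (hH : IsAlt H) {a b : Fin k} (hab : a ≠ b)
    (I : Fin k → ι) : H (I ∘ Equiv.swap a b) = -H I := by
  rw [hH, Equiv.Perm.sign_swap hab]; simp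

lemma IsAlt.raise {k : ℕ} {H : (Fin k → ι) → A} (hH : IsAlt H) (q : Matrix ι ι A) :
    IsAlt (raise q H) := by
  intro σ I
  simp only [DiffAlg.raise, Finset.mul_sum]
  rw [← (Equiv.arrowCongr σ.symm (Equiv.refl ι)).sum_comp]
  refine Finset.sum_congr rfl fun J _ => ?_
  have h1 : (Equiv.arrowCongr σ.symm (Equiv.refl ι)) J = J ∘ σ := by
    funext a; simp [Equiv.arrowCongr]
  rw [h1, hH, ← Equiv.prod_comp σ (fun a => q (I a) (J a))]
  simp only [Function.comp_apply]; ring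

lemma innProd_eq_sum_raise {k : ℕ} {q : Matrix ι ι A} (hq : ∀ i j, q i j = q j i)
    (S T : (Fin k → ι) → A) : innProd q S T = ∑ I, raise q S I * T I := by
  simp only [innProd, raise, Finset.sum_mul]
  rw [Finset.sum_comm]
  refine Finset.sum_congr rfl fun I _ => Finset.sum_congr rfl fun J _ => ?_
  simp only [hq (J _)]

lemma innProd_comm {k : ℕ} {q : Matrix ι ι A} (hq : ∀ i j, q i j = q j i)
    (S T : (Fin k → ι) → A) : innProd q S T = innProd q T S := by
  simp only [innProd]
  rw [Finset.sum_comm]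
  refine Finset.sum_congr rfl fun I _ => Finset.sum_congr rfl fun J _ => ?_
  simp only [hq (J _)]; ring

lemma raise_cons {k : ℕ} (q : Matrix ι ι A) (T : (Fin (k + 1) → ι) → A) (i : ι)
    (I : Fin k → ι) :
    raise q T (Fin.cons i I) = ∑ j, q i j * raise q (fun J => T (Fin.cons j J)) I := by
  simp only [raise, Finset.mul_sum]
  rw [sum_cons]
  simp only [Fin.prod_univ_succ, Fin.cons_zero, Fin.cons_succ, mul_assoc]

lemma formSqLow_symm {k : ℕ} {q : Matrix ι ι A} (hq : ∀ i j, q i j = q j i)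
    (H : (Fin (k + 1) → ι) → A) (a b : ι) : formSqLow q H a b = formSqLow q H b a :=
  innProd_comm hq _ _

lemma q_mul_formSqLow {k : ℕ} {q : Matrix ι ι A} (hq : ∀ i j, q i j = q j i)
    (H : (Fin (k + 1) → ι) → A) (l j : ι) :
    (q * formSqLow q H) l j = ∑ I, raise q H (Fin.cons l I) * H (Fin.cons j I) := by
  simp only [Matrix.mul_apply, formSqLow, Matrix.of_apply, innProd_eq_sum_raise hq, raise_cons,
    Finset.mul_sum, Finset.sum_mul]
  rw [Finset.sum_comm]
  simp only [mul_assoc]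

lemma trace_q_mul_formSqLow {k : ℕ} {q : Matrix ι ι A} (hq : ∀ i j, q i j = q j i)
    (H : (Fin (k + 1) → ι) → A) : (q * formSqLow q H).trace = innProd q H H := by
  rw [innProd_eq_sum_raise hq, sum_cons]
  simp only [Matrix.trace, Matrix.diag, q_mul_formSqLow hq]

/-- In the contraction of an alternating `H` with an alternating sum, each of the `k + 1` summands
contributes the same, as moving an index of `H` to the front costs the same sign. -/
lemma sum_alt_mul_alternation {k : ℕ} {H : (Fin (k + 1) → ι) → A} (hH : IsAlt H)
    (B : ι → (Fin k → ι) → A) :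
    ∑ I, H I * ∑ a : Fin (k + 1), (-1 : A) ^ (a : ℕ) * B (I a) (a.removeNth I)
      = (k + 1) * ∑ l, ∑ I, H (Fin.cons l I) * B l I := by
  simp only [Finset.mul_sum (s := (Finset.univ : Finset (Fin (k + 1))))]
  rw [Finset.sum_comm]
  have h1 : ∀ a : Fin (k + 1), ∑ I, H I * ((-1 : A) ^ (a : ℕ) * B (I a) (a.removeNth I))
      = ∑ l, ∑ I, H (Fin.cons l I) * B l I := by
    intro a
    rw [sum_insertNth a]
    refine Finset.sum_congr rfl fun l _ => Finset.sum_congr rfl fun I _ => ?_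
    rw [hH.insertNth, Fin.insertNth_apply_same, Fin.removeNth_insertNth]
    have : ((-1 : A) ^ (a : ℕ)) * (-1) ^ (a : ℕ) = 1 := by rw [← mul_pow]; simp
    linear_combination (H (Fin.cons l I) * B l I) * this
  simp [h1]

lemma sum_alt_mul_dExt {k : ℕ} (D : ι → Derivation ℝ A A) {H : (Fin (k + 1) → ι) → A}
    (hH : IsAlt H) (α : (Fin k → ι) → A) :
    ∑ I, H I * dExt D α I = (k + 1) * ∑ l, ∑ I, H (Fin.cons l I) * D l (α I) :=
  sum_alt_mul_alternation hH fun l I => D l (α I)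

lemma sum_alt_mul_of_closed {k : ℕ} {D : ι → Derivation ℝ A A} {H α : (Fin (k + 1) → ι) → A}
    (hH : IsAlt H) (hα : dExt D α = 0) (j : ι) :
    ∑ I, H I * D j (α I) = (k + 1) * ∑ l, ∑ I, H (Fin.cons l I) * D l (α (Fin.cons j I)) := by
  rw [← sum_alt_mul_alternation hH fun l I => D l (α (Fin.cons j I))]
  refine Finset.sum_congr rfl fun I _ => ?_
  congr 1
  have h := congrFun hα (Fin.cons j I)
  simp only [dExt, Fin.sum_univ_succ (n := k + 1), Fin.val_zero, pow_zero, one_mul, Fin.cons_zero,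
    Fin.removeNth_zero, Fin.tail_cons, Fin.cons_succ, Fin.val_succ, pow_succ, Pi.zero_apply] at h
  have h2 : ∀ a : Fin (k + 1),
      a.succ.removeNth (Fin.cons j I : Fin (k + 2) → ι) = Fin.cons j (a.removeNth I) := by
    intro a
    funext b
    cases b using Fin.cases <;> simp [Fin.removeNth]
  simp only [h2, mul_neg, mul_one, neg_mul, Finset.sum_neg_distrib] at h
  linear_combination h

/-- `δ|H|² = 2⟨H, δH⟩ + (k + 1) δg^{ab} (H²)_{ab}` for a form of degree `k + 1`. -/
lemma derivation_innProd_self {k : ℕ} {q : Matrix ι ι A} (hq : ∀ i j, q i j = q j i)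
    (δ : Derivation ℝ A A) {H : (Fin (k + 1) → ι) → A} (hH : IsAlt H) :
    δ (innProd q H H) = 2 * ∑ I, raise q H I * δ (H I)
      + (k + 1) * (q.map δ * formSqLow q H).trace := by
  have h1 : ∑ I, ∑ J, δ (∏ a, q (I a) (J a)) * (H I * H J)
      = (k + 1) * (q.map δ * formSqLow q H).trace := by
    simp only [derivation_prod, Finset.sum_mul]
    rw [Finset.sum_congr rfl fun _ _ => Finset.sum_comm, Finset.sum_comm]
    have h2 : ∀ a : Fin (k + 1), ∑ I, ∑ J,
        δ (q (I a) (J a)) * (∏ b ∈ Finset.univ.erase a, q (I b) (J b)) * (H I * H J)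
        = (q.map δ * formSqLow q H).trace := by
      intro a
      rw [sum_insertNth a]
      refine (Finset.sum_congr rfl fun i _ => Finset.sum_congr rfl fun I _ =>
        sum_insertNth a _).trans ?_
      simp only [Fin.insertNth_apply_same, hH.insertNth]
      have h3 : ∀ i j (I J : Fin k → ι), ∏ b ∈ Finset.univ.erase a,
          q ((a.insertNth i I : Fin (k + 1) → ι) b) ((a.insertNth j J : Fin (k + 1) → ι) b)
          = ∏ b, q (I b) (J b) := by
        intro i j I J
        have : (Finset.univ.erase a : Finset (Fin (k + 1)))
            = Finset.univ.map (Fin.succAboveEmb a) := by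
          ext b; simp [Fin.exists_succAbove_eq_iff]
        rw [this, Finset.prod_map]
        simp
      simp only [h3, Matrix.trace, Matrix.diag, Matrix.mul_apply, Matrix.map_apply, formSqLow,
        Matrix.of_apply, innProd, Finset.mul_sum]
      refine Finset.sum_congr rfl fun i _ => ?_
      rw [Finset.sum_comm]
      refine Finset.sum_congr rfl fun j _ => ?_
      rw [Finset.sum_comm]
      refine Finset.sum_congr rfl fun J _ => Finset.sum_congr rfl fun I _ => ?_
      have : ((-1 : A) ^ (a : ℕ)) * (-1) ^ (a : ℕ) = 1 := by rw [← mul_pow]; simp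
      simp only [hq (J _)]
      linear_combination (δ (q i j) * (∏ b, q (I b) (J b)) * H (Fin.cons i I)
        * H (Fin.cons j J)) * this
    simp [h2]
  have h2 : ∑ I, ∑ J, (∏ a, q (I a) (J a)) * (H J * δ (H I)) = ∑ I, raise q H I * δ (H I) := by
    simp only [raise, Finset.sum_mul, mul_assoc]
  have h3 : ∑ I, ∑ J, (∏ a, q (I a) (J a)) * (H I * δ (H J)) = ∑ I, raise q H I * δ (H I) := by
    rw [← h2, Finset.sum_comm]
    refine Finset.sum_congr rfl fun I _ => Finset.sum_congr rfl fun J _ => ?_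
    simp only [hq (J _)]
  rw [two_mul, ← h1]
  nth_rw 1 [← h2]
  rw [← h3]
  simp only [innProd, map_sum, Derivation.leibniz, smul_eq_mul, ← Finset.sum_add_distrib]
  exact Finset.sum_congr rfl fun I _ => Finset.sum_congr rfl fun J _ => by ring

end Basic

section

variable {D : ι → Derivation ℝ A A} {g q : Matrix ι ι A} {Γ : ι → Matrix ι ι A}

lemma prod_update {k : ℕ} (q : Matrix ι ι A) (I J : Fin k → ι) (a : Fin k) (m : ι) :
    ∏ b, q (Function.update I a m b) (J b)
      = q m (J a) * ∏ b ∈ Finset.univ.erase a, q (I b) (J b) := by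
  rw [← Finset.mul_prod_erase _ _ (Finset.mem_univ a), Function.update_self]
  congr 1
  refine Finset.prod_congr rfl fun b hb => ?_
  rw [Function.update_of_ne (Finset.ne_of_mem_erase hb)]

/-- The map `(J, m) ↦ (J with m in the place a, J a)` is an involution, so the roles of `J` and its
update may be exchanged in a sum. -/
lemma sum_update_comm {k : ℕ} (a : Fin k) (F : (Fin k → ι) → (Fin k → ι) → A) :
    ∑ J, ∑ m, F J (Function.update J a m) = ∑ J, ∑ m, F (Function.update J a m) J := by
  let τ : (Fin k → ι) × ι → (Fin k → ι) × ι := fun p => (Function.update p.1 a p.2, p.1 a)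
  have hτ : Function.Involutive τ := by
    rintro ⟨J, m⟩; simp [τ]
  rw [← Fintype.sum_prod_type' (f := fun J m => F J (Function.update J a m)),
    ← Fintype.sum_prod_type' (f := fun J m => F (Function.update J a m) J),
    ← Equiv.sum_comp (hτ.toPerm τ) (fun p => F (Function.update p.1 a p.2) p.1)]
  refine Finset.sum_congr rfl fun p _ => ?_
  simp [τ]

namespace LeviCivita

variable (hL : LeviCivita D g q Γ)
include hL

/-- Raising indices commutes with `∇_l`; on contravariant components the Christoffel terms have the
opposite sign. -/
lemma raise_nabla {k : ℕ} (l : ι) (T : (Fin k → ι) → A) (I : Fin k → ι) :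
    raise q (nabla D Γ l T) I = D l (raise q T I)
      + ∑ a, ∑ m, Γ l (I a) m * raise q T (Function.update I a m) := by
  have h1 : ∀ J, D l (∏ a, q (I a) (J a))
      = -(∑ a, ∑ m, Γ l (I a) m * ∏ b, q (Function.update I a m b) (J b))
        - ∑ a, ∑ m, Γ l (J a) m * ∏ b, q (I b) (Function.update J a m b) := by
    intro J
    rw [derivation_prod, ← Finset.sum_neg_distrib, ← Finset.sum_sub_distrib]
    refine Finset.sum_congr rfl fun a _ => ?_
    rw [hL.D_q_apply, sub_mul, neg_mul, Finset.sum_mul, Finset.sum_mul]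
    congr 1
    · congr 1
      refine Finset.sum_congr rfl fun m _ => ?_
      rw [prod_update, mul_assoc]
    · refine Finset.sum_congr rfl fun m _ => ?_
      simp only [hL.q_apply_symm (I _), prod_update, mul_assoc]
  have h2 : ∑ J, (∑ a, ∑ m, Γ l (I a) m * ∏ b, q (Function.update I a m b) (J b)) * T J
      = ∑ a, ∑ m, Γ l (I a) m * raise q T (Function.update I a m) := by
    simp only [raise, Finset.sum_mul, Finset.mul_sum]
    rw [Finset.sum_comm]
    refine Finset.sum_congr rfl fun a _ => ?_
    rw [Finset.sum_comm]
    simp only [mul_assoc]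
  have h3 : ∑ J, (∑ a, ∑ m, Γ l (J a) m * ∏ b, q (I b) (Function.update J a m b)) * T J
      = ∑ J, (∏ a, q (I a) (J a)) * ∑ a, ∑ m, Γ l m (J a) * T (Function.update J a m) := by
    simp only [Finset.sum_mul, Finset.mul_sum]
    rw [Finset.sum_comm]
    conv_rhs => rw [Finset.sum_comm]
    refine Finset.sum_congr rfl fun a _ => ?_
    have := sum_update_comm a fun J J' => Γ l (J a) (J' a) * (∏ b, q (I b) (J' b)) * T J
    simp only [Function.update_self] at this
    rw [this]
    exact Finset.sum_congr rfl fun J _ => Finset.sum_congr rfl fun m _ => by ring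
  rw [← h2]
  simp only [raise, nabla, mul_sub, Finset.sum_sub_distrib, ← h3, map_sum, Derivation.leibniz,
    smul_eq_mul, Finset.sum_add_distrib, h1]
  simp only [mul_comm (T _), neg_mul, Finset.sum_neg_distrib]
  ring

/-- `∂_l H^{lI} + Γ_l H^{lI} = -(d^*H)^I` for alternating `H`. -/
lemma divVec_raise_form {k : ℕ} {H : (Fin (k + 1) → ι) → A} (hH : IsAlt H) (I : Fin k → ι) :
    divVec D Γ (fun l => raise q H (Fin.cons l I)) = -raise q (codiff D q Γ H) I := by
  have h1 : raise q (codiff D q Γ H) I = -∑ l, raise q (nabla D Γ l H) (Fin.cons l I) := by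
    simp only [raise_cons]
    simp only [raise, codiff, mul_neg, Finset.sum_neg_distrib, Finset.mul_sum]
    congr 1
    rw [Finset.sum_comm]
    refine Finset.sum_congr rfl fun i _ => ?_
    rw [Finset.sum_comm]
    exact Finset.sum_congr rfl fun j _ => Finset.sum_congr rfl fun J _ => by ring
  rw [h1, neg_neg]
  simp only [hL.raise_nabla, Fin.sum_univ_succ, Fin.cons_zero, Fin.cons_succ, Fin.update_cons_zero,
    ← Fin.cons_update, divVec, Finset.sum_add_distrib]
  have h2 : ∑ l, ∑ m, Γ l l m * raise q H (Fin.cons m I)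
      = ∑ l, (Γ l).trace * raise q H (Fin.cons l I) := by
    rw [Finset.sum_comm]
    refine Finset.sum_congr rfl fun m _ => ?_
    rw [← Finset.sum_mul, hL.trace_eq]
  have h3 : ∑ l, ∑ b, ∑ m, Γ l (I b) m * raise q H (Fin.cons l (Function.update I b m)) = 0 := by
    rw [Finset.sum_comm]
    refine Finset.sum_eq_zero fun b _ => ?_
    simp only [mul_comm (Γ _ _ _)]
    refine sum_antisymm_mul_symm (fun l m => ?_) (fun l m => hL.Γ_symm _ _ _)
    rw [← (hH.raise q).swap (Fin.succ_ne_zero b)]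
    congr 1
    funext c
    cases c using Fin.cases with
    | zero =>
      rw [Function.comp_apply, Equiv.swap_apply_right, Fin.cons_zero, Fin.cons_succ,
        Function.update_self]
    | succ c =>
      by_cases hcb : c = b
      · subst hcb
        rw [Function.comp_apply, Equiv.swap_apply_left, Fin.cons_zero, Fin.cons_succ,
          Function.update_self]
      · have : Equiv.swap b.succ 0 c.succ = c.succ :=
          Equiv.swap_apply_of_ne_of_ne (by simpa using hcb) (Fin.succ_ne_zero c)
        simp [this, hcb]
  rw [h2, h3]; ring

end LeviCivita
end

end

/-! ### Evolution of the generalized scalar curvature in a differential algebra -/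

section

variable {A : Type*} [CommRing A] [Algebra ℝ A] {ι : Type*} [Fintype ι] [DecidableEq ι]
variable {D : ι → Derivation ℝ A A} {g q : Matrix ι ι A} {Γ : ι → Matrix ι ι A}

/-- The form `d^*H + i_{∇f} H`. -/
def twistedCod {k : ℕ} (D : ι → Derivation ℝ A A) (q : Matrix ι ι A) (Γ : ι → Matrix ι ι A)
    (f : A) (H : (Fin (k + 1) → ι) → A) : (Fin k → ι) → A :=
  fun I => codiff D q Γ H I + insVec (gradVec D q f) H I

lemma eq_smul_of_natCast_add_one_mul {k : ℕ} {a b : A} (h : ((k : A) + 1) * a = b) :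
    a = (1 / ((k : ℝ) + 1)) • b := by
  have h1 : ((k : A) + 1) = algebraMap ℝ A ((k : ℝ) + 1) := by simp
  rw [← h, h1, Algebra.smul_def, ← mul_assoc, ← map_mul, one_div_mul_cancel (by positivity),
    map_one, one_mul]

lemma raise_add {k : ℕ} (S T : (Fin k → ι) → A) (I : Fin k → ι) :
    raise q (fun J => S J + T J) I = raise q S I + raise q T I := by
  simp only [raise, mul_add, Finset.sum_add_distrib]

lemma raise_twistedCod {k : ℕ} (f : A) (H : (Fin (k + 1) → ι) → A) (I : Fin k → ι) :
    raise q (twistedCod D q Γ f H) I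
      = raise q (codiff D q Γ H) I + raise q (insVec (gradVec D q f) H) I :=
  raise_add _ _ _

lemma raise_insVec {k : ℕ} (X : ι → A) (H : (Fin (k + 1) → ι) → A) (I : Fin k → ι) :
    raise q (insVec X H) I = ∑ j, X j * raise q (fun J => H (Fin.cons j J)) I := by
  simp only [raise, insVec, Finset.mul_sum]
  rw [Finset.sum_comm]
  exact Finset.sum_congr rfl fun j _ => Finset.sum_congr rfl fun J _ => by ring

lemma divVec_sum_mul {κ : Type*} [Fintype κ] (V : κ → ι → A) (F : κ → A) :
    divVec D Γ (fun l => ∑ I, V I l * F I)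
      = ∑ I, divVec D Γ (V I) * F I + ∑ l, ∑ I, V I l * D l (F I) := by
  simp only [divVec, Finset.sum_mul]
  rw [Finset.sum_comm (s := Finset.univ (α := κ)), ← Finset.sum_add_distrib]
  refine Finset.sum_congr rfl fun l _ => ?_
  rw [map_sum, Finset.mul_sum, ← Finset.sum_add_distrib, ← Finset.sum_add_distrib]
  refine Finset.sum_congr rfl fun I _ => ?_
  rw [Derivation.leibniz, smul_eq_mul, smul_eq_mul]; ring

lemma divMixed_smul (c : ℝ) (T : Matrix ι ι A) (m : ι) : divMixed D Γ (c • T) m = c • divMixed D Γ T m := by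
  simp only [divMixed, Matrix.smul_apply, divVec_smul, mul_smul_comm, Matrix.trace_smul, smul_sub]

lemma divMixed_sum {κ : Type*} (s : Finset κ) (T : κ → Matrix ι ι A) (m : ι) :
    divMixed D Γ (∑ j ∈ s, T j) m = ∑ j ∈ s, divMixed D Γ (T j) m := by
  classical
  induction s using Finset.induction_on with
  | empty => simp [divMixed, divVec]
  | insert a s ha ih => rw [Finset.sum_insert ha, Finset.sum_insert ha, LeviCivita.divMixed_add, ih]

lemma divVec_sum {κ : Type*} (s : Finset κ) (V : κ → ι → A) :
    divVec D Γ (fun i => ∑ j ∈ s, V j i) = ∑ j ∈ s, divVec D Γ (V j) := by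
  simp only [divVec, map_sum, Finset.mul_sum, ← Finset.sum_add_distrib]
  rw [Finset.sum_comm]

namespace LeviCivita

variable (hL : LeviCivita D g q Γ)
include hL

lemma sum_D_mul_raise {k : ℕ} (f : A) (H : (Fin (k + 1) → ι) → A) (I : Fin k → ι) :
    ∑ l, raise q H (Fin.cons l I) * D l f = raise q (insVec (gradVec D q f) H) I := by
  simp only [raise_insVec, raise_cons, gradVec, Finset.sum_mul]
  rw [Finset.sum_comm]
  refine Finset.sum_congr rfl fun l _ => Finset.sum_congr rfl fun j _ => ?_
  rw [hL.q_apply_symm l]; ring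

/-- `(div_f H²)_m = (1/(2(k+1))) ∂_m |H|² - ⟨d^*H + i_{∇f}H, i_m H⟩` for a closed form of degree
`k + 1`. -/
lemma form_bianchi {k : ℕ} {H : (Fin (k + 1) → ι) → A} (hH : IsAlt H) (hd : dExt D H = 0)
    (f : A) (m : ι) :
    divMixed D Γ (q * formSqLow q H) m - ∑ l, (q * formSqLow q H) l m * D l f
      = (1 / ((k : ℝ) + 1)) • ((1 / 2 : ℝ) • D m (innProd q H H))
        - innProd q (twistedCod D q Γ f H) (fun I => H (Fin.cons m I)) := by
  have hq := hL.q_apply_symm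
  have h1 : divMixed D Γ (q * formSqLow q H) m
      = -innProd q (codiff D q Γ H) (fun I => H (Fin.cons m I))
        + ∑ l, ∑ I, raise q H (Fin.cons l I) * D l (H (Fin.cons m I))
        - (Γ m * (q * formSqLow q H)).trace := by
    rw [divMixed]
    simp only [q_mul_formSqLow hq, divVec_sum_mul (fun I l => raise q H (Fin.cons l I)),
      hL.divVec_raise_form hH, innProd_eq_sum_raise hq, neg_mul, Finset.sum_neg_distrib]
  have h2 : ∑ l, (q * formSqLow q H) l m * D l f
      = innProd q (insVec (gradVec D q f) H) (fun I => H (Fin.cons m I)) := by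
    simp only [q_mul_formSqLow hq, innProd_eq_sum_raise hq, ← hL.sum_D_mul_raise, Finset.sum_mul]
    rw [Finset.sum_comm]
    exact Finset.sum_congr rfl fun I _ => Finset.sum_congr rfl fun l _ => by ring
  have h3 := sum_alt_mul_of_closed (hH.raise q) hd m
  have h4 := derivation_innProd_self hq (D m) hH
  have h5 : (q.map (D m) * formSqLow q H).trace = -2 * (Γ m * (q * formSqLow q H)).trace := by
    have hs : (formSqLow q H)ᵀ = formSqLow q H := by
      ext a b; exact formSqLow_symm hq H b a
    rw [hL.D_q, sub_mul, neg_mul, Matrix.trace_sub, Matrix.trace_neg,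
      ← Matrix.trace_transpose ((Γ m * q)ᵀ * _), Matrix.transpose_mul, Matrix.transpose_transpose,
      hs, Matrix.trace_mul_comm (formSqLow q H), mul_assoc]
    ring
  have h6 : innProd q (twistedCod D q Γ f H) (fun I => H (Fin.cons m I))
      = innProd q (codiff D q Γ H) (fun I => H (Fin.cons m I))
        + innProd q (insVec (gradVec D q f) H) (fun I => H (Fin.cons m I)) := by
    simp only [innProd_eq_sum_raise hq, raise_twistedCod, add_mul, Finset.sum_add_distrib]
  rw [h5, h3] at h4
  have h7 : ((k : A) + 1) * (∑ l, ∑ I, raise q H (Fin.cons l I) * D l (H (Fin.cons m I))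
      - (Γ m * (q * formSqLow q H)).trace) = (1 / 2 : ℝ) • D m (innProd q H H) := by
    rw [h4]; algebra
  have h8 := eq_smul_of_natCast_add_one_mul h7
  rw [h1, h2, h6]
  linear_combination h8

/-- `div_f ⟨K, i H⟩ = H^{lI} ∂_l K_I - ⟨K, d^*H + i_{∇f}H⟩`. -/
lemma divVec_contraction {k : ℕ} {H : (Fin (k + 1) → ι) → A} (hH : IsAlt H) (f : A)
    (K : (Fin k → ι) → A) :
    divVec D Γ (fun i => ∑ j, q i j * innProd q K (fun I => H (Fin.cons j I)))
        - ∑ j, innProd q K (fun I => H (Fin.cons j I)) * gradVec D q f j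
      = ∑ l, ∑ I, raise q H (Fin.cons l I) * D l (K I) - innProd q K (twistedCod D q Γ f H) := by
  have hq := hL.q_apply_symm
  have h1 : ∀ i, ∑ j, q i j * innProd q K (fun I => H (Fin.cons j I))
      = ∑ I, raise q H (Fin.cons i I) * K I := by
    intro i
    simp only [innProd_comm hq K, innProd_eq_sum_raise hq, raise_cons, Finset.mul_sum, Finset.sum_mul]
    rw [Finset.sum_comm]
    simp only [mul_assoc]
  have h2 : ∑ j, innProd q K (fun I => H (Fin.cons j I)) * gradVec D q f j
      = ∑ I, raise q (insVec (gradVec D q f) H) I * K I := by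
    simp only [innProd_comm hq K, innProd_eq_sum_raise hq, raise_insVec, Finset.sum_mul]
    rw [Finset.sum_comm]
    exact Finset.sum_congr rfl fun I _ => Finset.sum_congr rfl fun l _ => by ring
  have h3 : innProd q K (twistedCod D q Γ f H) = ∑ I, raise q (codiff D q Γ H) I * K I
      + ∑ I, raise q (insVec (gradVec D q f) H) I * K I := by
    rw [innProd_comm hq]
    simp only [innProd_eq_sum_raise hq, raise_twistedCod, add_mul, Finset.sum_add_distrib]
  rw [funext h1, h2, h3, divVec_sum_mul (fun I l => raise q H (Fin.cons l I))]
  simp only [hL.divVec_raise_form hH, neg_mul, Finset.sum_neg_distrib]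
  ring

/-- The variation of `|H|² / (k + 1)` for a form of degree `k + 1`, when `δg = -2S`, `T = q S` and
`δH = -dK` with `K = d^*H + i_{∇f}H`. -/
lemma variation_innProd_self {k : ℕ} {H : (Fin (k + 1) → ι) → A} (hH : IsAlt H) (f : A)
    {δ : Derivation ℝ A A} {T : Matrix ι ι A} (hT : q.map δ = (2 : ℝ) • (T * q))
    (hδH : ∀ I, δ (H I) = -dExt D (twistedCod D q Γ f H) I) :
    (1 / ((k : ℝ) + 1)) • δ (innProd q H H)
      = (2 : ℝ) • ((T * (q * formSqLow q H)).trace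
        - innProd q (twistedCod D q Γ f H) (twistedCod D q Γ f H)
        - (divVec D Γ (fun i => ∑ j, q i j *
              innProd q (twistedCod D q Γ f H) (fun I => H (Fin.cons j I)))
          - ∑ j, innProd q (twistedCod D q Γ f H) (fun I => H (Fin.cons j I)) * gradVec D q f j)) := by
  have hq := hL.q_apply_symm
  rw [hL.divVec_contraction hH]
  have h1 := derivation_innProd_self hq δ hH
  simp only [hδH, mul_neg, Finset.sum_neg_distrib] at h1
  rw [sum_alt_mul_dExt D (hH.raise q), hT, smul_mul_assoc, Matrix.trace_smul, mul_assoc T] at h1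
  symm
  apply eq_smul_of_natCast_add_one_mul
  rw [h1]
  algebra

end LeviCivita

section Flow

variable {n : ℕ}

/-- The tensor `Rc - ¼H² + ∇²f`, for a form `H` of mixed degree. -/
noncomputable def genRicMat (D : ι → Derivation ℝ A A) (q : Matrix ι ι A) (Γ : ι → Matrix ι ι A)
    (H : (j : Fin n) → (Fin ((j : ℕ) + 1) → ι) → A) (f : A) : Matrix ι ι A :=
  ricMat D Γ - (1 / 4 : ℝ) • ∑ j, formSqLow q (H j) + hessMat D Γ f

/-- The generalized scalar curvature `R - ¼ ∑_k (1/k) |H_k|² + 2Δf - |∇f|²`. -/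
noncomputable def genScal (D : ι → Derivation ℝ A A) (q : Matrix ι ι A) (Γ : ι → Matrix ι ι A)
    (H : (j : Fin n) → (Fin ((j : ℕ) + 1) → ι) → A) (f : A) : A :=
  (q * ricMat D Γ).trace - (1 / 4 : ℝ) • ∑ j : Fin n, (1 / ((j : ℝ) + 1)) • innProd q (H j) (H j)
    + (2 : ℝ) • divVec D Γ (gradVec D q f) - ∑ l, D l f * gradVec D q f l

/-- The evolution of the generalized scalar curvature, `δρ = Δ_f ρ + 2|S|² + ½|K|²`. -/
theorem LeviCivita.evolution_genScal (hL : LeviCivita D g q Γ) {δ : Derivation ℝ A A}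
    (hδ : ∀ i a, δ (D i a) = D i (δ a))
    {H : (j : Fin n) → (Fin ((j : ℕ) + 1) → ι) → A} {f : A} (hH : ∀ j, IsAlt (H j))
    (hd : ∀ j, dExt D (H j) = 0)
    (hg : g.map δ = (-2 : ℝ) • genRicMat D q Γ H f)
    (hδH : ∀ j I, δ (H j I) = -dExt D (twistedCod D q Γ f (H j)) I)
    (hf : δ f = divVec D Γ (gradVec D q f)
      + (1 / 4 : ℝ) • ∑ j : Fin n, ((j : ℝ) / ((j : ℝ) + 1)) • innProd q (H j) (H j)
      - ∑ l, D l f * gradVec D q f l) :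
    δ (genScal D q Γ H f) = divVec D Γ (gradVec D q (genScal D q Γ H f))
      - ∑ l, D l f * gradVec D q (genScal D q Γ H f) l
      + (2 : ℝ) • (q * genRicMat D q Γ H f * (q * genRicMat D q Γ H f)).trace
      + (1 / 2 : ℝ) • ∑ j, innProd q (twistedCod D q Γ f (H j)) (twistedCod D q Γ f (H j)) := by
  have hq := hL.q_apply_symm
  set S := genRicMat D q Γ H f with hS
  set T := q * S with hTdef
  set ρ := genScal D q Γ H f with hρ
  set Rf := (q * ricMat D Γ).trace + 2 * divVec D Γ (gradVec D q f) - ∑ l, D l f * gradVec D q f l with hRf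
  have hρ' : ρ = Rf - (1 / 4 : ℝ) • ∑ j : Fin n, (1 / ((j : ℝ) + 1)) • innProd q (H j) (H j) := by
    rw [hρ, hRf, genScal]; algebra
  have hTX : T = q * ricMat D Γ + q * hessMat D Γ f
      + (-(1 / 4) : ℝ) • ∑ j, q * formSqLow q (H j) := by
    rw [hTdef, hS, genRicMat, ← Finset.mul_sum]
    simp only [mul_add, mul_sub, mul_smul_comm, neg_smul]
    abel
  have hT : q.map δ = (2 : ℝ) • (T * q) := by
    rw [map_inverse hL.q_mul_g, hg]
    rw [mul_smul_comm, smul_mul_assoc, ← neg_smul, neg_neg]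
  have htrT : T.trace = (q * ricMat D Γ).trace + divVec D Γ (gradVec D q f)
      - (1 / 4 : ℝ) • ∑ j, innProd q (H j) (H j) := by
    rw [hTX, Matrix.trace_add, Matrix.trace_add, hL.trace_q_mul_hessMat, Matrix.trace_smul,
      Matrix.trace_sum]
    simp only [trace_q_mul_formSqLow hq]
    algebra
  have hf' : δ f = ρ - T.trace := by
    have h1 : ∑ j : Fin n, ((j : ℝ) / ((j : ℝ) + 1)) • innProd q (H j) (H j)
        = ∑ j : Fin n, innProd q (H j) (H j)
          - ∑ j : Fin n, (1 / ((j : ℝ) + 1)) • innProd q (H j) (H j) := by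
      rw [← Finset.sum_sub_distrib]
      refine Finset.sum_congr rfl fun j _ => ?_
      have h2 : (j : ℝ) / ((j : ℝ) + 1) = 1 - 1 / ((j : ℝ) + 1) := by
        have : (j : ℝ) + 1 ≠ 0 := by positivity
        field_simp; ring
      rw [h2, sub_smul, one_smul]
    rw [hf, hρ', htrT, hRf, h1]; algebra
  -- the contraction of `d^*H + i_{∇f} H` with `i_m H`
  set κ : Fin n → ι → A := fun j m =>
    innProd q (twistedCod D q Γ f (H j)) (fun I => H j (Fin.cons m I)) with hκ
  have hB : ∀ m, 4 * (divMixed D Γ T m - ∑ l, T l m * D l f) = 2 * D m ρ + ∑ j, κ j m := by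
    intro m
    have h1 := hL.weighted_bianchi f m
    rw [← hRf] at h1
    have h2 : ∑ j, (divMixed D Γ (q * formSqLow q (H j)) m
        - ∑ l, (q * formSqLow q (H j)) l m * D l f)
        = (1 / 2 : ℝ) • D m (∑ j : Fin n, (1 / ((j : ℝ) + 1)) • innProd q (H j) (H j))
          - ∑ j, κ j m := by
      rw [map_sum, Finset.smul_sum, ← Finset.sum_sub_distrib]
      refine Finset.sum_congr rfl fun j _ => ?_
      rw [hL.form_bianchi (hH j) (hd j) f m, Derivation.map_smul, smul_comm]
    have h3 : ∑ l, T l m * D l f = ∑ l, (q * ricMat D Γ + q * hessMat D Γ f) l m * D l f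
        + (-(1 / 4) : ℝ) • ∑ j, ∑ l, (q * formSqLow q (H j)) l m * D l f := by
      rw [Finset.sum_comm, Finset.smul_sum, ← Finset.sum_add_distrib]
      refine Finset.sum_congr rfl fun l _ => ?_
      rw [hTX, Matrix.add_apply, Matrix.smul_apply, add_mul, Matrix.sum_apply, smul_mul_assoc,
        Finset.sum_mul]
    rw [Finset.sum_sub_distrib] at h2
    rw [h3, hρ', map_sub, Derivation.map_smul]
    conv_lhs => rw [hTX, divMixed_add, divMixed_smul, divMixed_sum]
    linear_combination (norm := algebra) 2 * h1 - h2
  have hR := hL.variation_weighted_scal hδ hT f ρ (fun m => ∑ j, κ j m) hf' hB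
  rw [← hRf] at hR
  have hN : δ (∑ j : Fin n, (1 / ((j : ℝ) + 1)) • innProd q (H j) (H j))
      = (2 : ℝ) • ((T * ∑ j, q * formSqLow q (H j)).trace
        - ∑ j, innProd q (twistedCod D q Γ f (H j)) (twistedCod D q Γ f (H j))
        - (divVec D Γ (fun i => ∑ m, q i m * ∑ j, κ j m)
          - ∑ m, (∑ j, κ j m) * gradVec D q f m)) := by
    have h1 : ∀ i, ∑ m, q i m * ∑ j, κ j m = ∑ j, ∑ m, q i m * κ j m := by
      intro i
      simp only [Finset.mul_sum]; rw [Finset.sum_comm]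
    have h2 : ∑ m, (∑ j, κ j m) * gradVec D q f m = ∑ j, ∑ m, κ j m * gradVec D q f m := by
      simp only [Finset.sum_mul]; rw [Finset.sum_comm]
    rw [funext h1, divVec_sum, h2, Finset.mul_sum, Matrix.trace_sum, ← Finset.sum_sub_distrib,
      ← Finset.sum_sub_distrib, ← Finset.sum_sub_distrib, Finset.smul_sum, map_sum]
    refine Finset.sum_congr rfl fun j _ => ?_
    rw [Derivation.map_smul, hL.variation_innProd_self (hH j) f hT (hδH j)]
  have hTT : (T * T).trace = (T * (q * ricMat D Γ + q * hessMat D Γ f)).trace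
      - (1 / 4 : ℝ) • (T * ∑ j, q * formSqLow q (H j)).trace := by
    have h1 := congrArg (T * ·) hTX
    simp only [mul_add T (_ + _), mul_smul_comm] at h1
    rw [h1, Matrix.trace_add, Matrix.trace_smul]
    algebra
  have h1 : δ ρ = δ Rf
      - (1 / 4 : ℝ) • δ (∑ j : Fin n, (1 / ((j : ℝ) + 1)) • innProd q (H j) (H j)) := by
    rw [← Derivation.map_smul, ← map_sub, ← hρ']
  rw [h1, hN, hTT]
  linear_combination (norm := algebra) (1 / 2 : ℝ) • hR

end Flow

end

/-! ### The differential algebra of smooth functions on `J × U` -/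

section SmoothFunctions

variable {E : Type*} [NormedAddCommGroup E] [NormedSpace ℝ E]

/-- The algebra of real functions on `S` which are restrictions of functions smooth on `S`. -/
def smoothSubalgebra (S : Set E) : Subalgebra ℝ (S → ℝ) where
  carrier := {u | ∃ F : E → ℝ, ContDiffOn ℝ ∞ F S ∧ ∀ x : S, u x = F x}
  mul_mem' := by
    rintro u v ⟨F, hF, hu⟩ ⟨G, hG, hv⟩
    exact ⟨fun x => F x * G x, hF.mul hG, fun x => by simp [hu, hv]⟩
  add_mem' := by
    rintro u v ⟨F, hF, hu⟩ ⟨G, hG, hv⟩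
    exact ⟨fun x => F x + G x, hF.add hG, fun x => by simp [hu, hv]⟩
  algebraMap_mem' r := ⟨fun _ => r, contDiffOn_const, fun x => rfl⟩

/-- The algebra `smoothSubalgebra S` as a type of its own, so that instance search does not unfold
the subalgebra. -/
def SmoothOn (S : Set E) : Type _ := smoothSubalgebra S

noncomputable instance (S : Set E) : CommRing (SmoothOn S) :=
  inferInstanceAs (CommRing (smoothSubalgebra S))

noncomputable instance (S : Set E) : Algebra ℝ (SmoothOn S) :=
  inferInstanceAs (Algebra ℝ (smoothSubalgebra S))

namespace SmoothOn

variable {S : Set E}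

/-- The restriction to `S` of a function smooth on `S`. -/
noncomputable def mk (F : E → ℝ) (hF : ContDiffOn ℝ ∞ F S) : SmoothOn S :=
  ⟨fun x => F x, F, hF, fun _ => rfl⟩

/-- Evaluation at a point of `S`. -/
noncomputable def ev (p : S) : SmoothOn S →ₐ[ℝ] ℝ :=
  (Pi.evalAlgHom ℝ (fun _ : S => ℝ) p).comp (smoothSubalgebra S).val

lemma ev_mk (F : E → ℝ) (hF : ContDiffOn ℝ ∞ F S) (p : S) : ev p (mk F hF) = F p := rfl

lemma ext_ev {a b : SmoothOn S} (h : ∀ p, ev p a = ev p b) : a = b :=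
  Subtype.ext (funext h)

lemma exists_extension (a : SmoothOn S) : ∃ F : E → ℝ, ContDiffOn ℝ ∞ F S ∧ ∀ p : S, ev p a = F p := a.2

/-- A function on the ambient space, smooth on `S`, that restricts to `a`. -/
noncomputable def lift (a : SmoothOn S) : E → ℝ := (exists_extension a).choose

lemma contDiffOn_lift (a : SmoothOn S) : ContDiffOn ℝ ∞ (lift a) S := (exists_extension a).choose_spec.1

lemma ev_eq_lift (a : SmoothOn S) (p : S) : ev p a = lift a p := (exists_extension a).choose_spec.2 p

lemma contDiffOn_fderivWithin_apply (hS : UniqueDiffOn ℝ S) (a : SmoothOn S) (v : E) :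
    ContDiffOn ℝ ∞ (fun x => fderivWithin ℝ (lift a) S x v) S :=
  ((contDiffOn_lift a).fderivWithin hS (by simp)).clm_apply contDiffOn_const

lemma differentiableWithinAt_lift (a : SmoothOn S) (p : S) :
    DifferentiableWithinAt ℝ (lift a) S p :=
  ((contDiffOn_lift a).differentiableOn (by simp)) p p.2

lemma fderivWithin_lift (a : SmoothOn S) {F : E → ℝ} (hF : ∀ p : S, ev p a = F p) (p : S) :
    fderivWithin ℝ (lift a) S p = fderivWithin ℝ F S p :=
  fderivWithin_congr (fun x hx => by rw [← hF ⟨x, hx⟩, ← ev_eq_lift _ ⟨x, hx⟩])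
    (by rw [← hF, ev_eq_lift])

/-- The derivative within `S` in the direction `v`; it does not depend on the choice of `lift`. -/
noncomputable def dirDer (hS : UniqueDiffOn ℝ S) (v : E) : Derivation ℝ (SmoothOn S) (SmoothOn S) :=
  Derivation.mk'
    { toFun := fun a => mk _ (contDiffOn_fderivWithin_apply hS a v)
      map_add' := fun a b => by
        refine ext_ev fun p => ?_
        rw [map_add, ev_mk, ev_mk, ev_mk, fderivWithin_lift (a + b) (F := lift a + lift b)
          (fun p => by rw [map_add, ev_eq_lift, ev_eq_lift]; rfl),
          fderivWithin_add (hS p p.2) (differentiableWithinAt_lift a p)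
            (differentiableWithinAt_lift b p)]
        rfl
      map_smul' := fun r a => by
        refine ext_ev fun p => ?_
        rw [map_smul, ev_mk, ev_mk, fderivWithin_lift (r • a) (F := r • lift a)
          (fun p => by rw [map_smul, ev_eq_lift]; rfl),
          fderivWithin_const_smul (hS p p.2) (differentiableWithinAt_lift a p)]
        rfl }
    (fun a b => by
      refine ext_ev fun p => ?_
      simp only [LinearMap.coe_mk, AddHom.coe_mk, smul_eq_mul, map_add, map_mul, ev_mk]
      rw [fderivWithin_lift (a * b) (F := lift a * lift b)
          (fun p => by rw [map_mul, ev_eq_lift, ev_eq_lift]; rfl),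
          fderivWithin_mul (hS p p.2) (differentiableWithinAt_lift a p)
            (differentiableWithinAt_lift b p), ev_eq_lift, ev_eq_lift]
      rfl)

lemma ev_dirDer (hS : UniqueDiffOn ℝ S) (v : E) (a : SmoothOn S) (p : S) :
    ev p (dirDer hS v a) = fderivWithin ℝ (lift a) S p v := rfl

/-- Second derivatives within `S` are symmetric also at boundary points, as limits of interior
points; this covers end points of the time interval. -/
lemma dirDer_comm (hS : UniqueDiffOn ℝ S) (hS' : S ⊆ closure (interior S)) (v w : E) (a : SmoothOn S) :
    dirDer hS v (dirDer hS w a) = dirDer hS w (dirDer hS v a) := by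
  have key : ∀ (v w : E) (p : S), ev p (dirDer hS v (dirDer hS w a))
      = fderivWithin ℝ (fderivWithin ℝ (lift a) S) S p v w := by
    intro v w p
    have hd : DifferentiableWithinAt ℝ (fderivWithin ℝ (lift a) S) S p :=
      (((contDiffOn_lift a).fderivWithin (m := 1) hS (by norm_cast)).differentiableOn (by simp)) p p.2
    rw [ev_dirDer, fderivWithin_lift (dirDer hS w a) (F := fun x => fderivWithin ℝ (lift a) S x w)
      (fun p => rfl), fderivWithin_clm_apply (hS p p.2) hd (differentiableWithinAt_const w)]
    simp
  refine ext_ev fun p => ?_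
  rw [key, key]
  exact (((contDiffOn_lift a) p p.2).isSymmSndFDerivWithinAt
    (by rw [minSmoothness_of_isRCLikeNormedField]; exact WithTop.coe_le_coe.2 le_top) hS (hS' p.2) p.2).eq v w

end SmoothOn

end SmoothFunctions

open SmoothOn

section Chart

variable {n : ℕ} {J : Set ℝ} {U : Set (Coord n)}

/-- The element `a` of the algebra is the restriction to `J × U` of `(t, y) ↦ F t y`. -/
def Represents (F : ℝ → Coord n → ℝ) (a : SmoothOn (J ×ˢ U)) : Prop :=
  ∀ p : ↥(J ×ˢ U), F p.1.1 p.1.2 = ev p a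

namespace Represents

variable (hS : UniqueDiffOn ℝ (J ×ˢ U)) {F : ℝ → Coord n → ℝ} {a : SmoothOn (J ×ˢ U)}

lemma contDiffOn (h : Represents F a) : ContDiffOn ℝ ∞ (fun p : ℝ × Coord n => F p.1 p.2) (J ×ˢ U) :=
  (contDiffOn_lift a).congr fun x hx => by rw [h ⟨x, hx⟩, ev_eq_lift]

lemma exists_of_contDiffOn
    (h : ContDiffOn ℝ ∞ (fun p : ℝ × Coord n => F p.1 p.2) (J ×ˢ U)) : ∃ a : SmoothOn (J ×ˢ U), Represents F a :=
  ⟨mk _ h, fun _ => rfl⟩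

lemma pd (hU : IsOpen U) (h : Represents F a) (i : Fin n) :
    Represents (fun t y => GenRicciFlow.pd i (F t) y) (dirDer hS (0, coordVec i) a) := by
  rintro ⟨⟨t, y⟩, ht, hy⟩
  have h1 : HasFDerivWithinAt (lift a) (fderivWithin ℝ (lift a) (J ×ˢ U) (t, y)) (J ×ˢ U) (t, y) :=
    (differentiableWithinAt_lift a ⟨(t, y), ht, hy⟩).hasFDerivWithinAt
  have h2 : HasFDerivWithinAt (fun z : Coord n => (t, z)) (ContinuousLinearMap.inr ℝ ℝ (Coord n))
      U y := (hasFDerivAt_prodMk_right t y).hasFDerivWithinAt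
  have h3 := (h1.comp y h2 (fun z hz => ⟨ht, hz⟩)).congr (f₁ := F t)
    (fun z hz => by rw [Function.comp_apply, ← ev_eq_lift a ⟨(t, z), ht, hz⟩]; exact h ⟨(t, z), ht, hz⟩)
    (by rw [Function.comp_apply, ← ev_eq_lift a ⟨(t, y), ht, hy⟩]; exact h ⟨(t, y), ht, hy⟩)
  rw [ev_dirDer]
  simp only [GenRicciFlow.pd, (h3.hasFDerivAt (hU.mem_nhds hy)).fderiv]
  simp

lemma hasDerivWithinAt (h : Represents F a) (p : ↥(J ×ˢ U)) :
    HasDerivWithinAt (fun s => F s p.1.2) (ev p (dirDer hS (1, 0) a)) J p.1.1 := by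
  obtain ⟨⟨t, y⟩, ht, hy⟩ := p
  have h1 : HasFDerivWithinAt (lift a) (fderivWithin ℝ (lift a) (J ×ˢ U) (t, y)) (J ×ˢ U) (t, y) :=
    (differentiableWithinAt_lift a ⟨(t, y), ht, hy⟩).hasFDerivWithinAt
  have h2 : HasDerivWithinAt (fun s : ℝ => (s, y)) ((1 : ℝ), (0 : Coord n)) J t :=
    (hasDerivWithinAt_id t J).prodMk (hasDerivWithinAt_const t J y)
  refine (h1.comp_hasDerivWithinAt t h2
    (show Set.MapsTo (fun s : ℝ => (s, y)) J (J ×ˢ U) from fun s hs => ⟨hs, hy⟩)).congr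
    (fun s hs => ?_) ?_
  · rw [Function.comp_apply, ← ev_eq_lift a ⟨(s, y), hs, hy⟩]; exact h ⟨(s, y), hs, hy⟩
  · rw [Function.comp_apply, ← ev_eq_lift a ⟨(t, y), ht, hy⟩]; exact h ⟨(t, y), ht, hy⟩

end Represents

lemma uniqueDiffOn_prod (hJ : J.OrdConnected) (hJ' : J.Nontrivial) (hU : IsOpen U) :
    UniqueDiffOn ℝ (J ×ˢ U) :=
  (uniqueDiffOn_convex hJ.convex (hJ.convex.nontrivial_iff_nonempty_interior.1 hJ')).prod hU.uniqueDiffOn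

lemma subset_closure_interior_prod (hJ : J.OrdConnected) (hJ' : J.Nontrivial) (hU : IsOpen U) :
    J ×ˢ U ⊆ closure (interior (J ×ˢ U)) := by
  have h := hJ.convex.closure_interior_eq_closure_of_nonempty_interior (𝕜 := ℝ)
    (hJ.convex.nontrivial_iff_nonempty_interior.1 hJ')
  rw [interior_prod_eq, closure_prod_eq, hU.interior_eq, h]
  exact Set.prod_mono subset_closure subset_closure

end Chart

/-! ### Coordinate expressions as elements of the algebra -/

section

variable {A : Type*} [CommRing A] [Algebra ℝ A] {ι : Type*} [Fintype ι] [DecidableEq ι]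

/-- The Christoffel symbols of the metric `g` with inverse `q`, with `chrMat D g q i k j = Γ^k_{ij}`. -/
noncomputable def chrMat (D : ι → Derivation ℝ A A) (g q : Matrix ι ι A) (i : ι) : Matrix ι ι A :=
  (1 / 2 : ℝ) • (q * Matrix.of fun l j => D i (g j l) + D j (g i l) - D l (g i j))

lemma leviCivita_chrMat {D : ι → Derivation ℝ A A} {g q : Matrix ι ι A}
    (hD : ∀ i j a, D i (D j a) = D j (D i a)) (hg : gᵀ = g) (hqg : q * g = 1) :
    LeviCivita D g q (chrMat D g q) := by
  have hgq : g * q = 1 := mul_eq_one_comm.mp hqg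
  have hg' : ∀ i j, g i j = g j i := fun i j => congrFun (congrFun hg j) i
  refine ⟨hD, hg, ?_, hqg, ?_, ?_⟩
  · calc qᵀ = q * (g * qᵀ) := by rw [← mul_assoc, hqg, one_mul]
      _ = q * (q * g)ᵀ := by rw [Matrix.transpose_mul, hg]
      _ = q := by rw [hqg, Matrix.transpose_one, mul_one]
  · intro i k j
    simp only [chrMat, Matrix.smul_apply, Matrix.mul_apply, Matrix.of_apply]
    congr 1
    refine Finset.sum_congr rfl fun l _ => ?_
    rw [hg' i j]; ring
  · intro i
    rw [chrMat, mul_smul_comm, ← mul_assoc, hgq, one_mul]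
    ext a b
    simp only [Matrix.map_apply, Matrix.add_apply, Matrix.smul_apply, Matrix.of_apply,
      Matrix.transpose_apply, hg' b a]
    algebra

end

section

variable {A : Type*} [CommRing A] [Algebra ℝ A] {ι : Type*} [Fintype ι] [DecidableEq ι]

/-- `|S|² = tr (q S q S)` for a symmetric 2-tensor `S`. -/
lemma innProd_two {q s : Matrix ι ι A} (hq : ∀ i j, q i j = q j i) (hs : ∀ i j, s i j = s j i) :
    innProd q (fun I : Fin 2 → ι => s (I 0) (I 1)) (fun I => s (I 0) (I 1))
      = (q * s * (q * s)).trace := by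
  have h2 : ∀ F : (Fin 2 → ι) → A, ∑ I, F I = ∑ a, ∑ b, F ![a, b] := fun F => by
    rw [← (finTwoArrowEquiv ι).symm.sum_comp, Fintype.sum_prod_type]; rfl
  have h1 : innProd q (fun I : Fin 2 → ι => s (I 0) (I 1)) (fun I => s (I 0) (I 1))
      = ∑ a, ∑ b, ∑ c, ∑ d, q a c * q b d * s a b * s c d := by
    simp only [innProd, h2, Fin.prod_univ_two, Matrix.cons_val_zero, Matrix.cons_val_one]
  have h3 : (q * s * (q * s)).trace = ∑ c, ∑ b, ∑ d, ∑ a, q c a * s a b * (q b d * s d c) := by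
    simp only [Matrix.trace, Matrix.diag, Matrix.mul_apply, Finset.sum_mul, Finset.mul_sum]
  rw [h1, h3]
  calc _ = ∑ a, ∑ c, ∑ b, ∑ d, q a c * q b d * s a b * s c d :=
        Finset.sum_congr rfl fun a _ => Finset.sum_comm
    _ = ∑ c, ∑ b, ∑ a, ∑ d, q a c * q b d * s a b * s c d := by
        rw [Finset.sum_comm]
        exact Finset.sum_congr rfl fun c _ => Finset.sum_comm
    _ = _ := by
        refine Finset.sum_congr rfl fun c _ => Finset.sum_congr rfl fun b _ => ?_
        rw [Finset.sum_comm]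
        refine Finset.sum_congr rfl fun d _ => Finset.sum_congr rfl fun a _ => ?_
        rw [hq c a, hs d c]; ring

end

section Chart

variable {n : ℕ} {J : Set ℝ} {U : Set (Coord n)} (hS : UniqueDiffOn ℝ (J ×ˢ U))

/-- The derivation `∂_i` of the algebra of smooth functions on `J × U`. -/
noncomputable def partialDer (i : Fin n) :
    Derivation ℝ (SmoothOn (J ×ˢ U)) (SmoothOn (J ×ˢ U)) := dirDer hS (0, coordVec i)

variable (hU : IsOpen U) {G : ℝ → Coord n → Matrix (Fin n) (Fin n) ℝ}
  {g q : Matrix (Fin n) (Fin n) (SmoothOn (J ×ˢ U))}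
  (hg : ∀ i j, Represents (fun t y => G t y i j) (g i j))
  (hq : ∀ i j, Represents (fun t y => (G t y)⁻¹ i j) (q i j))

lemma represents_pd {F : ℝ → Coord n → ℝ} {a : SmoothOn (J ×ˢ U)} (hU : IsOpen U) (h : Represents F a)
    (i : Fin n) (p : ↥(J ×ˢ U)) :
    pd i (fun z => F p.1.1 z) p.1.2 = ev p (partialDer hS i a) := h.pd hS hU i p

include hU hg hq

local notation "∂" => partialDer hS
local notation "Γ" => chrMat (partialDer hS) g q

lemma represents_christoffel (k i j : Fin n) :
    Represents (fun t y => christoffel (G t) k i j y) (Γ i k j) := by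
  intro p
  have h1 : ∀ i j, (G p.1.1 p.1.2)⁻¹ i j = ev p (q i j) := fun i j => hq i j p
  have h2 : ∀ i j l, pd i (fun z => G p.1.1 z j l) p.1.2 = ev p (∂ i (g j l)) :=
    fun i j l => represents_pd hS hU (hg j l) i p
  simp only [christoffel, chrMat, Matrix.smul_apply, Matrix.mul_apply, Matrix.of_apply, map_smul,
    map_sum, map_mul, map_add, map_sub, smul_eq_mul, h1, h2]

lemma represents_riemann (l i j k : Fin n) :
    Represents (fun t y => riemann (G t) l i j k y) (curvMat ∂ Γ i j l k) := by
  intro p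
  have h1 : ∀ k i j, christoffel (G p.1.1) k i j p.1.2 = ev p (Γ i k j) :=
    fun k i j => represents_christoffel hS hU hg hq k i j p
  have h2 : ∀ a k i j, pd a (christoffel (G p.1.1) k i j) p.1.2 = ev p (∂ a (Γ i k j)) :=
    fun a k i j => represents_pd hS hU (represents_christoffel hS hU hg hq k i j) a p
  simp only [riemann, curvMat, Matrix.add_apply, Matrix.sub_apply, Matrix.mul_apply,
    Matrix.map_apply, map_add, map_sub, map_sum, map_mul, h1, h2, Finset.sum_sub_distrib]

lemma represents_ricci (j k : Fin n) : Represents (fun t y => ricci (G t) y j k) (ricMat ∂ Γ j k) := by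
  intro p
  have h1 : ∀ l i j k, riemann (G p.1.1) l i j k p.1.2 = ev p (curvMat ∂ Γ i j l k) :=
    fun l i j k => represents_riemann hS hU hg hq l i j k p
  simp only [ricci, ricMat, Matrix.of_apply, map_sum, h1]

omit hU hg in
lemma represents_trace {S : ℝ → Coord n → Fin n → Fin n → ℝ}
    {s : Matrix (Fin n) (Fin n) (SmoothOn (J ×ˢ U))} (hqs : ∀ i j, q i j = q j i)
    (hs : ∀ i j, Represents (fun t y => S t y i j) (s i j)) :
    Represents (fun t y => trace (G t) y (S t y)) (q * s).trace := by
  intro p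
  have h1 : ∀ i j, (G p.1.1 p.1.2)⁻¹ i j = ev p (q i j) := fun i j => hq i j p
  have h2 : ∀ i j, S p.1.1 p.1.2 i j = ev p (s i j) := fun i j => hs i j p
  simp only [GenRicciFlow.trace, Matrix.trace, Matrix.diag, Matrix.mul_apply, map_sum, map_mul, h1, h2]
  rw [Finset.sum_comm]
  exact Finset.sum_congr rfl fun i _ => Finset.sum_congr rfl fun j _ => by rw [hqs]

variable {f : ℝ → Coord n → ℝ} {a : SmoothOn (J ×ˢ U)} (hf : Represents f a)

include hf

omit hg in
lemma represents_grad (i : Fin n) : Represents (fun t y => grad (G t) (f t) y i) (gradVec ∂ q a i) := by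
  intro p
  have h1 : ∀ i j, (G p.1.1 p.1.2)⁻¹ i j = ev p (q i j) := fun i j => hq i j p
  have h2 : ∀ i, pd i (f p.1.1) p.1.2 = ev p (∂ i a) := fun i => represents_pd hS hU hf i p
  simp only [grad, gradVec, map_sum, map_mul, h1, h2]

omit hg in
lemma represents_gradInner {u : ℝ → Coord n → ℝ} {b : SmoothOn (J ×ˢ U)} (hu : Represents u b) :
    Represents (fun t y => gradInner (G t) (f t) (u t) y) (∑ l, ∂ l b * gradVec ∂ q a l) := by
  intro p
  have h1 : ∀ i, grad (G p.1.1) (f p.1.1) p.1.2 i = ev p (gradVec ∂ q a i) :=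
    fun i => represents_grad hS hU hq hf i p
  have h2 : ∀ i, pd i (u p.1.1) p.1.2 = ev p (∂ i b) := fun i => represents_pd hS hU hu i p
  simp only [gradInner, map_sum, map_mul, h1, h2, mul_comm]

lemma represents_hess (i j : Fin n) : Represents (fun t y => hess (G t) (f t) y i j) (hessMat ∂ Γ a i j) := by
  intro p
  have h1 : ∀ k i j, christoffel (G p.1.1) k i j p.1.2 = ev p (Γ i k j) :=
    fun k i j => represents_christoffel hS hU hg hq k i j p
  have h2 : ∀ i, pd i (f p.1.1) p.1.2 = ev p (∂ i a) := fun i => represents_pd hS hU hf i p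
  have h3 : ∀ i j, pd i (pd j (f p.1.1)) p.1.2 = ev p (∂ i (∂ j a)) :=
    fun i j => represents_pd hS hU (hf.pd hS hU j) i p
  simp only [hess, hessMat, Matrix.of_apply, map_sub, map_sum, map_mul, h1, h2, h3]

lemma represents_lap (hL : LeviCivita ∂ g q Γ) :
    Represents (fun t y => lap (G t) (f t) y) (divVec ∂ Γ (gradVec ∂ q a)) := by
  rw [← hL.trace_q_mul_hessMat]
  exact represents_trace hq hL.q_apply_symm (represents_hess hS hU hg hq hf)

omit hf
variable {k : ℕ} {T T' : ℝ → Coord n → Comp n k}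
  {τ τ' : (Fin k → Fin n) → SmoothOn (J ×ˢ U)} (hT : ∀ I, Represents (fun t y => T t y I) (τ I))
  (hT' : ∀ I, Represents (fun t y => T' t y I) (τ' I))
  {W : ℝ → Coord n → Comp n (k + 1)} {θ : (Fin (k + 1) → Fin n) → SmoothOn (J ×ˢ U)}
  (hW : ∀ I, Represents (fun t y => W t y I) (θ I))

omit hU hg in
include hT hT' in
lemma represents_tensorInner :
    Represents (fun t y => tensorInner (G t) y (T t y) (T' t y)) (innProd q τ τ') := by
  intro p
  have h1 : ∀ i j, (G p.1.1 p.1.2)⁻¹ i j = ev p (q i j) := fun i j => hq i j p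
  have h2 : ∀ I, T p.1.1 p.1.2 I = ev p (τ I) := fun I => hT I p
  have h3 : ∀ I, T' p.1.1 p.1.2 I = ev p (τ' I) := fun I => hT' I p
  simp only [tensorInner, innProd, map_sum, map_mul, map_prod, h1, h2, h3]

omit hU hg hq in
include hW in
lemma represents_interior {X : ℝ → Coord n → Fin n → ℝ} {ξ : Fin n → SmoothOn (J ×ˢ U)}
    (hX : ∀ i, Represents (fun t y => X t y i) (ξ i)) (I : Fin k → Fin n) :
    Represents (fun t y => GenRicciFlow.interior (X t y) (W t y) I) (insVec ξ θ I) := by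
  intro p
  have h1 : ∀ i, X p.1.1 p.1.2 i = ev p (ξ i) := fun i => hX i p
  have h2 : ∀ I, W p.1.1 p.1.2 I = ev p (θ I) := fun I => hW I p
  simp only [GenRicciFlow.interior, insVec, map_sum, map_mul, h1, h2]

omit hg hq in
include hT in
lemma represents_extD (I : Fin (k + 1) → Fin n) :
    Represents (fun t y => extD (T t) y I) (dExt ∂ τ I) := by
  intro p
  have h1 : ∀ i I, pd i (fun z => T p.1.1 z I) p.1.2 = ev p (∂ i (τ I)) :=
    fun i I => represents_pd hS hU (hT I) i p
  simp only [extD, dExt, map_sum, map_mul, map_pow, map_neg, map_one, h1]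

include hT in
lemma represents_covDeriv (i : Fin n) (I : Fin k → Fin n) :
    Represents (fun t y => covDeriv (G t) (T t) y (Fin.cons i I)) (nabla ∂ Γ i τ I) := by
  intro p
  have h1 : ∀ i I, pd i (fun z => T p.1.1 z I) p.1.2 = ev p (∂ i (τ I)) :=
    fun i I => represents_pd hS hU (hT I) i p
  have h2 : ∀ I, T p.1.1 p.1.2 I = ev p (τ I) := fun I => hT I p
  have h3 : ∀ k i j, christoffel (G p.1.1) k i j p.1.2 = ev p (Γ i k j) :=
    fun k i j => represents_christoffel hS hU hg hq k i j p
  simp only [covDeriv, nabla, Fin.cons_zero, Fin.tail_cons, map_sub, map_sum, map_mul, h1, h2, h3]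

include hW in
lemma represents_coD (I : Fin k → Fin n) :
    Represents (fun t y => coD (G t) (W t) y I) (codiff ∂ q Γ θ I) := by
  intro p
  have h1 : ∀ i j, (G p.1.1 p.1.2)⁻¹ i j = ev p (q i j) := fun i j => hq i j p
  have h2 : ∀ i I, covDeriv (G p.1.1) (W p.1.1) p.1.2 (Fin.cons i I) = ev p (nabla ∂ Γ i θ I) :=
    fun i I => represents_covDeriv hS hU hg hq hW i I p
  simp only [coD, codiff, map_neg, map_sum, map_mul, h1, h2]

include hf hW in
lemma represents_twistedCod (I : Fin k → Fin n) :
    Represents (fun t y => coD (G t) (W t) y I + GenRicciFlow.interior (grad (G t) (f t) y) (W t y) I)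
      (twistedCod ∂ q Γ a θ I) := by
  intro p
  have h1 := represents_coD hS hU hg hq hW I p
  have h2 := represents_interior hW (represents_grad hS hU hq hf) I p
  simp only at h1 h2
  simp only [twistedCod, map_add, h1, h2]

variable {H : ℝ → (j : Fin n) → Coord n → Comp n (j + 1)}
  {η : (j : Fin n) → (Fin ((j : ℕ) + 1) → Fin n) → SmoothOn (J ×ˢ U)}
  (hH : ∀ j I, Represents (fun t y => H t j y I) (η j I))

include hH

omit hU hg in
lemma represents_formSq (a b : Fin n) :
    Represents (fun t y => formSq (G t) (H t) y a b) ((∑ j, formSqLow q (η j)) a b) := by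
  intro p
  rw [Matrix.sum_apply, map_sum]
  refine Finset.sum_congr rfl fun j _ => ?_
  have h : ∀ a I, Represents (fun t y => GenRicciFlow.interior (Pi.single a 1) (H t j y) I)
      (η j (Fin.cons a I)) := by
    intro a I p
    have := hH j (Fin.cons a I) p
    simpa [GenRicciFlow.interior, Pi.single_apply] using this
  exact represents_tensorInner hq (h a) (h b) p

omit hU hg in
lemma represents_sum_innProd (c : Fin n → ℝ) :
    Represents (fun t y => ∑ j : Fin n, c j * tensorInner (G t) y (H t j y) (H t j y))
      (∑ j, c j • innProd q (η j) (η j)) := by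
  intro p
  have h1 : ∀ j, tensorInner (G p.1.1) p.1.2 (H p.1.1 j p.1.2) (H p.1.1 j p.1.2)
      = ev p (innProd q (η j) (η j)) := fun j => represents_tensorInner hq (hH j) (hH j) p
  simp only [map_sum, map_smul, smul_eq_mul, h1]

include hf

lemma represents_genRicciSym (I : Fin 2 → Fin n) :
    Represents (fun t y => genRicciSym (G t) (H t) (f t) y I) (genRicMat ∂ q Γ η a (I 0) (I 1)) := by
  intro p
  have h1 := represents_ricci hS hU hg hq (I 0) (I 1) p
  have h2 := represents_formSq hq hH (I 0) (I 1) p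
  have h3 := represents_hess hS hU hg hq hf (I 0) (I 1) p
  simp only at h1 h2 h3
  simp only [genRicciSym, genRicMat, Matrix.add_apply, Matrix.sub_apply, Matrix.smul_apply, map_add,
    map_sub, map_smul, smul_eq_mul, h1, h2, h3]

lemma represents_genScalar (hL : LeviCivita ∂ g q Γ) :
    Represents (fun t y => genScalar (G t) (H t) (f t) y) (genScal ∂ q Γ η a) := by
  intro p
  have h1 := represents_trace hq hL.q_apply_symm (represents_ricci hS hU hg hq) p
  have h2 := represents_sum_innProd hq hH (fun j => 1 / ((j : ℝ) + 1)) p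
  have h3 := represents_lap hS hU hg hq hf hL p
  have h4 := represents_gradInner hS hU hq hf hf p
  simp only at h1 h2 h3 h4
  simp only [genScalar, genScal, map_add, map_sub, map_smul, smul_eq_mul, scalarCurv, wNormSq, ← h1,
    ← h2, ← h3, ← h4]

lemma represents_genRicciNormSq (hL : LeviCivita ∂ g q Γ) :
    Represents (fun t y => genRicciNormSq (G t) (H t) (f t) y)
      ((q * genRicMat ∂ q Γ η a * (q * genRicMat ∂ q Γ η a)).trace
        + (1 / 4 : ℝ) • ∑ j, innProd q (twistedCod ∂ q Γ a (η j)) (twistedCod ∂ q Γ a (η j))) := by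
  intro p
  have hs : ∀ i j, genRicMat ∂ q Γ η a i j = genRicMat ∂ q Γ η a j i := by
    intro i j
    simp only [genRicMat, Matrix.add_apply, Matrix.sub_apply, Matrix.smul_apply, Matrix.sum_apply,
      hL.hessMat_symm a i j, formSqLow_symm hL.q_apply_symm _ i j]
    rw [← congrFun (congrFun hL.ricMat_symm i) j, Matrix.transpose_apply]
  have h1 := represents_tensorInner hq (represents_genRicciSym hS hU hg hq hf hH)
    (represents_genRicciSym hS hU hg hq hf hH) p
  have h2 : ∀ j, tensorInner (G p.1.1) p.1.2 (genRicciForm (G p.1.1) (H p.1.1) (f p.1.1) p.1.2 j)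
      (genRicciForm (G p.1.1) (H p.1.1) (f p.1.1) p.1.2 j)
      = 1 / 4 * ev p (innProd q (twistedCod ∂ q Γ a (η j)) (twistedCod ∂ q Γ a (η j))) := by
    intro j
    rw [← represents_tensorInner hq (represents_twistedCod hS hU hg hq hf (hH j))
      (represents_twistedCod hS hU hg hq hf (hH j)) p]
    simp only [tensorInner, genRicciForm, Finset.mul_sum]
    exact Finset.sum_congr rfl fun I _ => Finset.sum_congr rfl fun J _ => by ring
  rw [← innProd_two hL.q_apply_symm hs, map_add, ← h1, map_smul, map_sum, smul_eq_mul, Finset.mul_sum]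
  refine congrArg₂ (· + ·) rfl ?_
  exact Finset.sum_congr rfl fun j _ => h2 j

end Chart

/-! ### Geometric input from the manifold -/

section Manifold

variable {n : ℕ} {M : Type*} [TopologicalSpace M] [ChartedSpace (EuclideanSpace ℝ (Fin n)) M]

lemma formComp_comp_perm (H : MixedForm n M) (e : OpenPartialHomeomorph M (Coord n)) (j : Fin n)
    (y : Coord n) (σ : Equiv.Perm (Fin ((j : ℕ) + 1))) (I : Fin ((j : ℕ) + 1) → Fin n) :
    formComp H e j y (I ∘ σ) = (Equiv.Perm.sign σ : ℤ) * formComp H e j y I := by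
  have := (H j (e.symm y)).toAlternatingMap.map_perm (fun a => frame e y (I a)) σ
  rw [Units.smul_def, zsmul_eq_mul] at this
  exact this

variable [IsManifold (𝓡 n) ∞ M]

lemma mfderiv_symm_injective {e : OpenPartialHomeomorph M (Coord n)}
    (he : e ∈ IsManifold.maximalAtlas (𝓡 n) ∞ M) {y : Coord n} (hy : y ∈ e.target) :
    Function.Injective (mfderiv 𝓘(ℝ, EuclideanSpace ℝ (Fin n)) (𝓡 n) e.symm y) := by
  have h1 : MDifferentiableAt 𝓘(ℝ, EuclideanSpace ℝ (Fin n)) (𝓡 n) e.symm y :=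
    ((contMDiffOn_symm_of_mem_maximalAtlas he).contMDiffAt
      (e.open_target.mem_nhds hy)).mdifferentiableAt (by simp)
  have h2 : MDifferentiableAt (𝓡 n) 𝓘(ℝ, EuclideanSpace ℝ (Fin n)) e (e.symm y) :=
    ((contMDiffOn_of_mem_maximalAtlas he).contMDiffAt
      (e.open_source.mem_nhds (e.map_target hy))).mdifferentiableAt (by simp)
  have h3 : e ∘ e.symm =ᶠ[𝓝 y] id := by
    filter_upwards [e.open_target.mem_nhds hy] with z hz using e.right_inv hz
  have h4 := mfderiv_comp y h2 h1
  rw [h3.mfderiv_eq, mfderiv_id] at h4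
  intro v w hvw
  have h5 : ∀ v, (mfderiv (𝓡 n) 𝓘(ℝ, EuclideanSpace ℝ (Fin n)) e (e.symm y))
      (mfderiv 𝓘(ℝ, EuclideanSpace ℝ (Fin n)) (𝓡 n) e.symm y v) = v :=
    fun v => (congrArg (fun L => L v) h4).symm
  rw [← h5 v, ← h5 w, hvw]

lemma metricComp_transpose (g : Metric n M) (e : OpenPartialHomeomorph M (Coord n))
    (y : Coord n) (i j : Fin n) : metricComp g e y i j = metricComp g e y j i :=
  g.symm _ _ _

/-- The component matrix is nondegenerate since the metric is positive definite and the coordinate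
frame is linearly independent. -/
lemma det_metricComp_ne_zero (g : Metric n M) {e : OpenPartialHomeomorph M (Coord n)}
    (he : e ∈ IsManifold.maximalAtlas (𝓡 n) ∞ M) {y : Coord n} (hy : y ∈ e.target) :
    (metricComp g e y).det ≠ 0 := by
  intro h
  obtain ⟨v, hv, hGv⟩ := Matrix.exists_mulVec_eq_zero_iff.mpr h
  set L := mfderiv 𝓘(ℝ, EuclideanSpace ℝ (Fin n)) (𝓡 n) e.symm y with hL
  set w : Coord n := ∑ i, v i • coordVec i with hw
  have hLw : L w = ∑ i, v i • frame e y i := by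
    rw [hw]
    exact (map_sum L _ _).trans (Finset.sum_congr rfl fun i _ => map_smul L _ _)
  have h0 : g.inner (e.symm y) (L w) (L w) = 0 := by
    have : g.inner (e.symm y) (L w) (L w) = ∑ i, v i * (metricComp g e y *ᵥ v) i := by
      rw [hLw]
      simp only [map_sum, map_smul, _root_.sum_apply, _root_.smul_apply,
        smul_eq_mul, Matrix.mulVec, dotProduct, metricComp, Matrix.of_apply, Finset.mul_sum]
      rw [Finset.sum_comm]
      exact Finset.sum_congr rfl fun i _ => Finset.sum_congr rfl fun j _ => by ring
    rw [this, hGv]; simp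
  have hLw0 : L w = 0 := by
    by_contra hne
    exact (g.pos _ _ hne).ne' h0
  have hw0 : w = 0 := mfderiv_symm_injective he hy (hLw0.trans (map_zero L).symm)
  apply hv
  funext i
  have := congrArg (fun u : Coord n => u i) hw0
  simpa [hw, coordVec, Pi.single_apply] using this

end Manifold

section

variable {n : ℕ} {J : Set ℝ} {U : Set (Coord n)}

lemma exists_extensionresents_inv {G : ℝ → Coord n → Matrix (Fin n) (Fin n) ℝ}
    (hG : ∀ i j, ContDiffOn ℝ ∞ (fun p : ℝ × Coord n => G p.1 p.2 i j) (J ×ˢ U))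
    (hdet : ∀ t ∈ J, ∀ y ∈ U, (G t y).det ≠ 0) :
    ∃ q : Matrix (Fin n) (Fin n) (SmoothOn (J ×ˢ U)),
      ∀ i j, Represents (fun t y => (G t y)⁻¹ i j) (q i j) := by
  have hd : ∀ F : ℝ × Coord n → Matrix (Fin n) (Fin n) ℝ,
      (∀ i j, ContDiffOn ℝ ∞ (fun p => F p i j) (J ×ˢ U)) →
      ContDiffOn ℝ ∞ (fun p => (F p).det) (J ×ˢ U) := by
    intro F hF
    simp only [Matrix.det_apply']
    exact ContDiffOn.sum fun σ _ => contDiffOn_const.mul (contDiffOn_prod fun i _ => hF _ _)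
  have h : ∀ i j, ContDiffOn ℝ ∞ (fun p : ℝ × Coord n => (G p.1 p.2)⁻¹ i j) (J ×ˢ U) := by
    intro i j
    simp only [Matrix.inv_def, Matrix.smul_apply, Ring.inverse_eq_inv', smul_eq_mul,
      Matrix.adjugate_apply]
    refine ContDiffOn.mul ((hd _ hG).inv fun p hp => hdet _ hp.1 _ hp.2) (hd _ fun a b => ?_)
    by_cases hab : a = j
    · subst hab
      simp only [Matrix.updateRow_self]
      exact contDiffOn_const
    · simp only [Matrix.updateRow_ne hab]
      exact hG a b
  choose q hq using fun i j => Represents.exists_of_contDiffOn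
    (F := fun t y => (G t y)⁻¹ i j) (h i j)
  exact ⟨Matrix.of q, hq⟩

lemma dExt_add {A : Type*} [CommRing A] [Algebra ℝ A] {ι : Type*} {k : ℕ}
    (D : ι → Derivation ℝ A A) (α β : (Fin k → ι) → A) (I : Fin (k + 1) → ι) :
    dExt D (fun I => α I + β I) I = dExt D α I + dExt D β I := by
  simp only [dExt, map_add, mul_add, Finset.sum_add_distrib]

lemma codiff_zero {A : Type*} [CommRing A] [Algebra ℝ A] {ι : Type*} [Fintype ι] [DecidableEq ι]
    {k : ℕ} (D : ι → Derivation ℝ A A) (q : Matrix ι ι A) (Γ : ι → Matrix ι ι A) :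
    codiff D q Γ (0 : (Fin (k + 1) → ι) → A) = 0 := by
  funext I
  simp [codiff, nabla]

end

end DiffAlg

open DiffAlg

theorem proposition2p3 {n : ℕ} {M : Type*} [TopologicalSpace M]
    [ChartedSpace (EuclideanSpace ℝ (Fin n)) M] [IsManifold (𝓡 n) ∞ M]
    (J : Set ℝ) (hJ : J.OrdConnected) (hJ' : J.Nontrivial)
    (g : ℝ → Metric n M) (H : ℝ → MixedForm n M) (f : ℝ → M → ℝ)
    (hflow : IsGenRicciFlow J g H f) (hclosed : ∀ t ∈ J, IsClosedForm (H t)) :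
    ∀ e ∈ IsManifold.maximalAtlas (𝓡 n) ∞ M,
      ContDiffOn ℝ ∞ (fun p : ℝ × EuclideanSpace ℝ (Fin n) => flowScalar g H f e p.1 p.2)
        (J ×ˢ e.target) ∧
      ∀ t ∈ J, ∀ y ∈ e.target,
        weightedBox J (fun s => metricComp (g s) e) (fun s => funComp (f s) e)
            (flowScalar g H f e) t y
          = 2 * genRicciNormSq (metricComp (g t) e) (formComp (H t) e) (funComp (f t) e) y := by
  intro e he
  have hU : IsOpen e.target := e.open_target
  have hS := uniqueDiffOn_prod hJ hJ' hU
  have hS' := subset_closure_interior_prod hJ hJ' hU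
  have hJu : UniqueDiffOn ℝ J :=
    uniqueDiffOn_convex hJ.convex (hJ.convex.nontrivial_iff_nonempty_interior.1 hJ')
  have hdet : ∀ t ∈ J, ∀ y ∈ e.target, (metricComp (g t) e y).det ≠ 0 :=
    fun t _ y hy => det_metricComp_ne_zero (g t) he hy
  choose γ hγ using fun i j => Represents.exists_of_contDiffOn (F := fun t y => metricComp (g t) e y i j)
    (hflow.smooth_metric e he i j)
  obtain ⟨q, hq⟩ := exists_extensionresents_inv (G := fun t y => metricComp (g t) e y)
    (hflow.smooth_metric e he) hdet
  choose η hη using fun j I => Represents.exists_of_contDiffOn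
    (F := fun t y => formComp (H t) e j y I) (hflow.smooth_form e he j I)
  obtain ⟨a, ha⟩ := Represents.exists_of_contDiffOn (F := fun t y => funComp (f t) e y)
    (hflow.smooth_fun e he)
  set D := partialDer hS with hD
  set δ := SmoothOn.dirDer hS (1, 0) with hδ
  set G : Matrix (Fin n) (Fin n) (SmoothOn (J ×ˢ e.target)) := Matrix.of γ with hG
  have hg : ∀ i j, Represents (fun t y => metricComp (g t) e y i j) (G i j) := hγ
  have hL : LeviCivita D G q (chrMat D G q) := by
    refine leviCivita_chrMat (fun i j b => SmoothOn.dirDer_comm hS hS' _ _ b) ?_ ?_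
    · ext i j
      refine SmoothOn.ext_ev fun p => ?_
      rw [Matrix.transpose_apply, ← hg, ← hg]
      exact metricComp_transpose _ _ _ _ _
    · ext i j
      refine SmoothOn.ext_ev fun p => ?_
      have h1 := congrFun (congrFun (Matrix.nonsing_inv_mul (metricComp (g p.1.1) e p.1.2)
        (isUnit_iff_ne_zero.mpr (hdet _ p.2.1 _ p.2.2))) i) j
      simp only [Matrix.mul_apply] at h1
      simp only [Matrix.mul_apply, map_sum, map_mul, ← hg _ _ p, ← hq _ _ p, h1]
      by_cases hij : i = j <;> simp [Matrix.one_apply, hij]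
  have hder : ∀ {F : ℝ → Coord n → ℝ} {b : SmoothOn (J ×ˢ e.target)} (_ : Represents F b)
      (p : ↥(J ×ˢ e.target)) {F' : ℝ}, HasDerivWithinAt (fun s => F s p.1.2) F' J p.1.1 →
      SmoothOn.ev p (δ b) = F' := fun hb p _ h =>
    (hJu _ p.2.1).eq_deriv _ (hb.hasDerivWithinAt hS p) h
  have hδD : ∀ i b, δ (D i b) = D i (δ b) := fun i b => SmoothOn.dirDer_comm hS hS' _ _ b
  have halt : ∀ j, IsAlt (η j) := by
    intro j σ I
    refine SmoothOn.ext_ev fun p => ?_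
    rw [map_mul, map_intCast, ← hη, ← hη]
    exact formComp_comp_perm _ _ _ _ _ _
  have hd : ∀ j, dExt D (η j) = 0 := by
    intro j
    funext I
    refine SmoothOn.ext_ev fun p => ?_
    rw [← represents_extD hS hU (hη j) I p]
    exact congrFun (hclosed _ p.2.1 e he _ p.2.2 j) I
  have hδg : G.map δ = (-2 : ℝ) • genRicMat D q (chrMat D G q) η a := by
    ext i j
    refine SmoothOn.ext_ev fun p => ?_
    have h : genRicciSym (metricComp (g p.1.1) e) (formComp (H p.1.1) e) (funComp (f p.1.1) e)
        p.1.2 ![i, j] = SmoothOn.ev p (genRicMat D q (chrMat D G q) η a i j) :=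
      represents_genRicciSym hS hU hg hq ha hη ![i, j] p
    rw [Matrix.map_apply, hder (hg i j) p (hflow.evol_metric e he _ p.2.1 _ p.2.2 i j),
      Matrix.smul_apply, map_smul, ← h]
    simp only [genRicciSym, Matrix.cons_val_zero, Matrix.cons_val_one, smul_eq_mul]
    ring
  have hδH : ∀ j I, δ (η j I) = -dExt D (twistedCod D q (chrMat D G q) a (η j)) I := by
    intro j I
    refine SmoothOn.ext_ev fun p => ?_
    rw [hder (hη j I) p (hflow.evol_form e he _ p.2.1 _ p.2.2 j I)]
    have h1 := represents_extD hS hU (represents_coD hS hU hg hq (hη j)) I p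
    have h2 := represents_extD hS hU (represents_interior (hη j) (represents_grad hS hU hq ha)) I p
    have h3 := represents_coD hS hU hg hq (represents_extD hS hU (hη j)) I p
    -- the summand `d^* d` of the Hodge Laplacian vanishes since `H` is closed
    rw [← hD, hd j, codiff_zero, Pi.zero_apply, map_zero] at h3
    simp only [hodgeLap]
    unfold twistedCod
    rw [dExt_add, map_neg, map_add, ← h1, ← h2]
    linear_combination -h3
  have hδf : δ a = divVec D (chrMat D G q) (gradVec D q a)
      + (1 / 4 : ℝ) • ∑ j : Fin n, ((j : ℝ) / ((j : ℝ) + 1)) • innProd q (η j) (η j)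
      - ∑ l, D l a * gradVec D q a l := by
    refine SmoothOn.ext_ev fun p => ?_
    rw [hder ha p (hflow.evol_fun e he _ p.2.1 _ p.2.2), map_sub, map_add, map_smul,
      ← represents_lap hS hU hg hq ha hL p, ← represents_gradInner hS hU hq ha ha p,
      ← represents_sum_innProd hq hη (fun j => (j : ℝ) / ((j : ℝ) + 1)) p]
    rfl
  have hρ : Represents (flowScalar g H f e) (genScal D q (chrMat D G q) η a) :=
    represents_genScalar hS hU hg hq ha hη hL
  refine ⟨hρ.contDiffOn, fun t ht y hy => ?_⟩
  have hmain := hL.evolution_genScal hδD halt hd hδg hδH hδf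
  set p : ↥(J ×ˢ e.target) := ⟨(t, y), ht, hy⟩ with hp
  have h1 := (hρ.hasDerivWithinAt hS p).derivWithin (hJu t ht)
  have h2 := represents_lap hS hU hg hq hρ hL p
  have h3 := represents_gradInner hS hU hq ha hρ p
  have h4 := represents_genRicciNormSq hS hU hg hq ha hη hL p
  have h5 := congrArg (SmoothOn.ev p) hmain
  have h6 := hL.sum_D_mul_gradVec (genScal D q (chrMat D G q) η a) a
  simp only [hp] at h1 h2 h3 h4
  rw [weightedBox, h1, h2, h3, h4]
  rw [← hδ, h5, ← hD, h6]
  simp only [map_add, map_sub, map_smul, smul_eq_mul]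
  ring
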